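/- Let $L\in\mathbb N$. For a compact subgroup $\mathcal G$ of the orthogonal group $\mathrm O(L)$, $\theta\in\mathbb R^L$ and $\sigma>0$, let $\mathrm P_\theta$ be the law of $Y=G\theta+\sigma\xi$, where $G$ is uniformly (Haar) distributed on $\mathcal G$ and $\xi\sim\mathcal N(0,I_L)$ is independent of $G$. Let $D(\theta\,\|\,\phi)$ be the Kullback-Leibler divergence of $\mathrm P_\theta$ from $\mathrm P_\phi$ (with the same $\sigma$), and let $\rho(\theta,\phi)=\min_{G\in\mathcal G}\|\theta-G\phi\|$. For a linear subspace $\mathcal T\subseteq\mathbb R^L$ and observations $Y_1,\dots,Y_n$, an MLE constrained to lie in $\mathcal T$ is a measurable function $\tilde\theta_n=\tilde\theta_n(Y_1,\dots,Y_n)$ with $$\tilde\theta_n\in\operatorname*{argmax}_{\phi\in\mathcal T}\ \sum_{i=1}^n\log \mathbb E_G\Big[\exp\Big(-\frac{1}{2\sigma^2}\|Y_i-G\phi\|^2\Big)\Big],$$ where $\mathbb E_G$ is the expectation over $G$ uniform on $\mathcal G$. **Theorem.** Let $k\ge 1$ be real and let $c,C>0$. There are positive constants $C',C''$ and numbers $C_\sigma$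 with $C_\sigma\le C''\sigma^{6k-5}$ for all $\sigma>0$, where $C',C''$ depend only on $L,k,c,C$ and $C_\sigma$ only on these and $\sigma$, such that the following holds for every compact subgroup $\mathcal G$ of $\mathrm O(L)$ and every linear subspace $\mathcal T$ of $\mathbb R^L$. Suppose that $$D(\theta\,\|\,\phi)\ \ge\ C\sigma^{-2k}\rho^2(\theta,\phi)$$ for all $\theta,\phi\in\mathcal T$ and $\sigma\in\mathbb R$ with $c^{-1}\le\|\theta\|\le c$ and $\sigma\ge\|\theta\|$. Then for all $\theta\in\mathcal T$ and $\sigma\in\mathbb R$ with $c^{-1}\le\|\theta\|\le c$ and $\sigma\ge\|\theta\|$, all $n\ge1$, and every MLE $\tilde\theta_n$ constrained to lie in $\mathcal T$ based on i.i.d. observations $Y_1,\dots,Y_n\sim\mathrm P_\theta$, the expectation of $\rho(\tilde\theta_n,\theta)$ is finite and $$\mathbb E_\theta[\rho(\tilde\theta_n,\theta)]\ \le\ C'\frac{\sigma^k}{\sqrt n}+C_\sigma\frac{\log n}{n}.$$ -/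

import Mathlib

open MeasureTheory

noncomputable section

namespace OrbitModel

/-- Euclidean space `ℝ^L` with its `ℓ²` norm. -/
abbrev Signal (L : ℕ) : Type := EuclideanSpace ℝ (Fin L)

/-- The orthogonal group `O(L)`, as a topological group of real matrices. -/
abbrev O (L : ℕ) : Submonoid (Matrix (Fin L) (Fin L) ℝ) := Matrix.orthogonalGroup (Fin L) ℝ

/-- Subgroups of `O(L)` carry the Borel σ-algebra of the subspace topology. -/
instance instMeasurableSpaceSubgroup {L : ℕ} (G : Subgroup (O L)) : MeasurableSpace G := borel G

instance instBorelSpaceSubgroup {L : ℕ} (G : Subgroup (O L)) : BorelSpace G := ⟨rfl⟩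

/-- The action of `O(L)` on `ℝ^L` by matrix-vector multiplication. -/
def act {L : ℕ} (g : O L) (θ : Signal L) : Signal L :=
  WithLp.toLp 2 (Matrix.mulVec (g : Matrix (Fin L) (Fin L) ℝ) θ.ofLp)

/-- The loss `ρ(φ, θ) = min_{g ∈ G} ‖φ - g θ‖`. -/
def rho {L : ℕ} (G : Subgroup (O L)) (φ θ : Signal L) : ℝ :=
  ⨅ g : G, ‖φ - act (g : O L) θ‖

/-- The uniform distribution on a compact group `G`: the Haar measure of total mass one. -/
def unif {L : ℕ} (G : Subgroup (O L)) [CompactSpace G] : Measure G :=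
  Measure.haarMeasure (⊤ : TopologicalSpace.PositiveCompacts G)

/-- The law `P_θ` of `Y = g θ + σ ξ`, where `g` is uniform on `G` and `ξ` is an independent
standard Gaussian vector of `ℝ^L`. -/
def law {L : ℕ} (G : Subgroup (O L)) [CompactSpace G] (σ : ℝ) (θ : Signal L) :
    Measure (Signal L) :=
  ((unif G).prod (ProbabilityTheory.stdGaussian (Signal L))).map
    (fun p => act (p.1 : O L) θ + σ • p.2)

/-- The log-likelihood (up to an additive constant that does not depend on `φ`) of the sample `y`:
`∑ᵢ log E_g exp(-‖yᵢ - g φ‖² / (2σ²))`, with `g` uniform on `G`. -/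
def logLik {L : ℕ} (G : Subgroup (O L)) [CompactSpace G] (σ : ℝ) {n : ℕ}
    (y : Fin n → Signal L) (φ : Signal L) : ℝ :=
  ∑ i, Real.log (∫ g : G, Real.exp (-(1 / (2 * σ ^ 2)) * ‖y i - act (g : O L) φ‖ ^ 2) ∂(unif G))

/-- `est` is a maximum likelihood estimator constrained to lie in `T`: a measurable function of the
sample `y` which takes its values in `T` and maximizes the likelihood of `y` over `T`. -/
structure IsConstrainedMLE {L : ℕ} (G : Subgroup (O L)) [CompactSpace G]
    (T : Submodule ℝ (Signal L)) (σ : ℝ) {n : ℕ}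
    (est : (Fin n → Signal L) → Signal L) : Prop where
  measurable : Measurable est
  mem : ∀ y, est y ∈ T
  isMaxOn : ∀ y, IsMaxOn (logLik G σ y) (T : Set (Signal L)) (est y)

end OrbitModel

end

/-! Dividing by `σ` reduces everything to unit noise and `‖θ‖ ≤ 1`, where the hypothesis becomes a
lower bound `lam * ρ²` on the divergence with `lam = C σ^(2-2k)`. It then suffices to bound the risk
by `C₁ / √(lam n) + C₂ log n / (n lam³)` (`exists_risk_bound`). Multiplying by `σ` turns these two
terms into orders `σ^k / √n` and `σ^(6k-5) log n / n`.

The likelihood is constant on orbits, so the MLE may be replaced by the point `θ + δ` of its orbit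
closest to `θ`. Then `‖δ‖ = ρ`, the increment `incr` of the log-likelihood has expectation at most
`-lam ‖δ‖²`, and its empirical mean is nonnegative. The increment is a cumulant generating function
under the posterior of the group element. Its second order expansion is score + (posterior
covariance - `‖δ‖²`)/2, with a cubic error. By the information identity the divergence is half the
Fisher quadratic form up to a cubic error.

Local regime, `‖δ‖` at most a small multiple of `lam`: the cubic errors are absorbed, so the Fisher
form dominates `lam ‖δ‖²`. Normalizing the empirical score by the Fisher form plus `lam`
(`scoreDev`), instead of by `lam` alone, gives `lam ‖δ‖² ≤ 16 * scoreDev`, where `scoreDev` has mean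
at most `L / n` whatever `lam` is (`sq_norm_le_scoreDev`). Hence the rate `1 / √(lam n)`.

Far regime: increments are sub-Gaussian with variance proxy of order `‖δ‖²`. A union bound over a
grid of mesh `1/n` gives `‖δ‖²` of order `log n / (n lam²)` (`sq_norm_le_of_notMem_gridBad`). Since
`‖δ‖` exceeds a multiple of `lam`, dividing by it yields `log n / (n lam³)`.

The remaining exceptional events contribute smaller terms through second moments, and
`norm_le_deviation_terms` adds all the cases into one pointwise bound. -/

noncomputable section

namespace OrbitModel

open ProbabilityTheory
open scoped RealInnerProductSpace

/-! ### The orthogonal action, Haar measure on a compact group, and the orbit distance. -/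

section Action

variable {L : ℕ}

lemma act_add (g : O L) (θ φ : Signal L) : act g (θ + φ) = act g θ + act g φ := by
  simp [act, Matrix.mulVec_add]

lemma act_smul (g : O L) (a : ℝ) (θ : Signal L) : act g (a • θ) = a • act g θ := by
  simp [act, Matrix.mulVec_smul]

lemma act_sub (g : O L) (θ φ : Signal L) : act g (θ - φ) = act g θ - act g φ := by
  simp [act, Matrix.mulVec_sub]

lemma act_mul (g h : O L) (θ : Signal L) : act (g * h) θ = act g (act h θ) := by
  simp [act]

lemma act_one (θ : Signal L) : act (1 : O L) θ = θ := by
  simp [act]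

lemma norm_act (g : O L) (θ : Signal L) : ‖act g θ‖ = ‖θ‖ := by
  have hg : (g : Matrix (Fin L) (Fin L) ℝ).transpose * (g : Matrix (Fin L) (Fin L) ℝ) = 1 := by
    have := (Matrix.mem_orthogonalGroup_iff' (Fin L) ℝ).1 g.2
    simpa [Matrix.star_eq_conjTranspose] using this
  have h : ‖act g θ‖ ^ 2 = ‖θ‖ ^ 2 := by
    rw [EuclideanSpace.real_norm_sq_eq, EuclideanSpace.real_norm_sq_eq]
    have h1 : ∀ v : Fin L → ℝ, ∑ i, v i ^ 2 = v ⬝ᵥ v := fun v => by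
      simp [dotProduct, sq]
    rw [h1, h1]
    simp only [act]
    rw [Matrix.dotProduct_mulVec, Matrix.vecMul_mulVec, hg, Matrix.vecMul_one]
  exact (sq_eq_sq₀ (norm_nonneg _) (norm_nonneg _)).1 h

lemma inner_act (g : O L) (θ φ : Signal L) : ⟪act g θ, act g φ⟫ = ⟪θ, φ⟫ := by
  rw [real_inner_eq_norm_mul_self_add_norm_mul_self_sub_norm_sub_mul_self_div_two,
    real_inner_eq_norm_mul_self_add_norm_mul_self_sub_norm_sub_mul_self_div_two, ← act_sub,
    norm_act, norm_act, norm_act]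

variable (G : Subgroup (O L))

lemma continuous_act : Continuous fun p : G × Signal L => act (p.1 : O L) p.2 := by
  unfold act
  refine (PiLp.continuous_toLp 2 _).comp (Continuous.matrix_mulVec ?_ ?_)
  · exact continuous_subtype_val.comp (continuous_subtype_val.comp continuous_fst)
  · exact (PiLp.continuous_ofLp 2 _).comp continuous_snd

lemma continuous_act_left (θ : Signal L) : Continuous fun g : G => act (g : O L) θ :=
  (continuous_act G).comp (continuous_id.prodMk continuous_const)

variable [CompactSpace G]

instance instIsHaarMeasureUnif : (unif G).IsHaarMeasure := by unfold unif; infer_instance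

instance instIsProbabilityMeasureUnif : IsProbabilityMeasure (unif G) :=
  ⟨by simpa [unif] using
    Measure.haarMeasure_self (K₀ := (⊤ : TopologicalSpace.PositiveCompacts G))⟩

/-- Compact groups are unimodular: a right translate of Haar measure is again left invariant, hence
a multiple of it, and the total mass forces the factor to be one. -/
lemma unif_map_mul_right (h : G) : (unif G).map (fun g => g * h) = unif G := by
  have hp : IsProbabilityMeasure ((unif G).map (fun g => g * h)) :=
    Measure.isProbabilityMeasure_map (measurable_mul_const h).aemeasurable
  have := Measure.isMulInvariant_eq_smul_of_compactSpace ((unif G).map (fun g => g * h)) (unif G)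
  have h1 : ((unif G).map (fun g => g * h)) Set.univ = 1 := measure_univ
  rw [this, Measure.smul_apply, measure_univ] at h1
  have h2 : Measure.haarScalarFactor ((unif G).map (fun g => g * h)) (unif G) = 1 := by
    simpa [ENNReal.smul_def] using h1
  rw [this, h2, one_smul]

lemma integral_unif_mul_right (h : G) (f : G → ℝ) :
    ∫ g, f (g * h) ∂(unif G) = ∫ g, f g ∂(unif G) := by
  conv_rhs => rw [← unif_map_mul_right G h]
  exact ((MeasurableEquiv.mulRight h).measurableEmbedding.integral_map f).symm

lemma rho_le (φ θ : Signal L) (g : G) : rho G φ θ ≤ ‖φ - act (g : O L) θ‖ :=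
  ciInf_le ⟨0, by rintro _ ⟨g, rfl⟩; exact norm_nonneg _⟩ g

lemma rho_nonneg (φ θ : Signal L) : 0 ≤ rho G φ θ := Real.iInf_nonneg fun _ => norm_nonneg _

lemma exists_rho_eq (φ θ : Signal L) : ∃ g : G, rho G φ θ = ‖φ - act (g : O L) θ‖ := by
  have hc : Continuous fun g : G => ‖φ - act (g : O L) θ‖ :=
    (continuous_const.sub (continuous_act_left G θ)).norm
  obtain ⟨g, -, hg⟩ := isCompact_univ.exists_isMinOn (Set.univ_nonempty (α := G)) hc.continuousOn
  refine ⟨g, le_antisymm (rho_le G φ θ g) (le_ciInf fun h => hg (Set.mem_univ h))⟩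

lemma rho_comm (φ θ : Signal L) : rho G φ θ = rho G θ φ := by
  have key : ∀ φ θ : Signal L, rho G φ θ ≤ rho G θ φ := fun φ θ => by
    obtain ⟨g, hg⟩ := exists_rho_eq G θ φ
    refine (rho_le G φ θ g⁻¹).trans ?_
    rw [hg, ← norm_act (((g : G) : O L)) (φ - _), act_sub, ← act_mul, norm_sub_rev]
    simp [act_one]
  exact le_antisymm (key _ _) (key _ _)

/-- The orbit distance is 1-Lipschitz; this makes the loss of a measurable estimator measurable. -/
lemma continuous_rho_left (θ : Signal L) : Continuous fun φ => rho G φ θ := by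
  refine (LipschitzWith.of_le_add fun φ φ' => ?_).continuous
  obtain ⟨g, hg⟩ := exists_rho_eq G φ' θ
  rw [hg, dist_eq_norm]
  refine (rho_le G φ θ g).trans ?_
  calc ‖φ - act (g : O L) θ‖ = ‖(φ' - act (g : O L) θ) + (φ - φ')‖ := by congr 1; abel
    _ ≤ _ := norm_add_le _ _

lemma rho_smul {a : ℝ} (ha : 0 ≤ a) (φ θ : Signal L) : rho G (a • φ) (a • θ) = a * rho G φ θ := by
  unfold rho
  rw [Real.mul_iInf_of_nonneg ha]
  refine iInf_congr fun g => ?_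
  rw [act_smul, ← smul_sub, norm_smul, Real.norm_of_nonneg ha]

end Action

/-! ### Cameron-Martin formula for the standard Gaussian. -/

section GaussianShift

variable {L : ℕ}

lemma integral_cexp_stdGaussian (t a : Signal L) :
    ∫ x, Complex.exp ((⟪x, t⟫ : ℝ) * Complex.I + (⟪x, a⟫ : ℝ)) ∂(stdGaussian (Signal L)) =
      Complex.exp (∑ j, ((t j : ℂ) * Complex.I + a j) ^ 2 / 2) := by
  rw [← map_pi_eq_stdGaussian, integral_map (by fun_prop)
    (Measurable.aestronglyMeasurable (by fun_prop))]
  have h1 : ∀ x : Fin L → ℝ, Complex.exp ((⟪(WithLp.toLp 2 x : Signal L), t⟫ : ℝ) * Complex.I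
      + (⟪(WithLp.toLp 2 x : Signal L), a⟫ : ℝ)) =
      ∏ j, Complex.exp (((t j : ℂ) * Complex.I + a j) * (x j : ℝ)) := fun x => by
    rw [← Complex.exp_sum]
    congr 1
    simp only [PiLp.inner_apply, RCLike.inner_apply, conj_trivial]
    push_cast
    rw [Finset.sum_mul, ← Finset.sum_add_distrib]
    exact Finset.sum_congr rfl fun j _ => by ring
  simp_rw [h1]
  rw [integral_fintype_prod_eq_prod
    (f := fun j (x : ℝ) => Complex.exp (((t j : ℂ) * Complex.I + a j) * (x : ℝ))), Complex.exp_sum]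
  refine Finset.prod_congr rfl fun j _ => ?_
  have := complexMGF_gaussianReal (X := id) (p := gaussianReal 0 1) Measure.map_id
    ((t j : ℂ) * Complex.I + a j)
  simpa [complexMGF] using this

/-- A Bochner integral that is nonzero can only come from an integrable function, and the closed
form of the complex integral at `t = 0` is an exponential. -/
lemma integrable_exp_inner (a : Signal L) :
    Integrable (fun x : Signal L => Real.exp ⟪x, a⟫) (stdGaussian (Signal L)) := by
  have h := integral_cexp_stdGaussian 0 a
  have h2 : Integrable (fun x : Signal L => Complex.exp ((⟪x, (0 : Signal L)⟫ : ℝ) * Complex.I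
      + (⟪x, a⟫ : ℝ))) (stdGaussian (Signal L)) := by
    by_contra hc
    rw [integral_undef hc] at h
    exact Complex.exp_ne_zero _ h.symm
  refine h2.norm.congr (ae_of_all _ fun x => ?_)
  simp [Complex.norm_exp]

/-- Both sides are finite measures, so comparing characteristic functions is enough; the complex
exponential moment computes the one on the right. -/
lemma stdGaussian_map_add (a : Signal L) :
    (stdGaussian (Signal L)).map (fun x => x + a) = (stdGaussian (Signal L)).withDensity
      (fun x => ENNReal.ofReal (Real.exp (⟪x, a⟫ - ‖a‖ ^ 2 / 2))) := by
  have hint : Integrable (fun x : Signal L => Real.exp (⟪x, a⟫ - ‖a‖ ^ 2 / 2))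
      (stdGaussian (Signal L)) := by
    simp_rw [Real.exp_sub]
    exact (integrable_exp_inner a).div_const _
  have hf := isFiniteMeasure_withDensity_ofReal hint.2
  have hp : IsProbabilityMeasure ((stdGaussian (Signal L)).map (fun x => x + a)) :=
    Measure.isProbabilityMeasure_map (measurable_id.add_const a).aemeasurable
  refine Measure.ext_of_charFun (funext fun t => ?_)
  rw [charFun_map_add_const, charFun_stdGaussian, charFun_apply,
    integral_withDensity_eq_integral_toReal_smul (by fun_prop) (by simp)]
  have h1 : ∀ x : Signal L, (ENNReal.ofReal (Real.exp (⟪x, a⟫ - ‖a‖ ^ 2 / 2))).toReal •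
      Complex.exp ((⟪x, t⟫ : ℝ) * Complex.I) = Complex.exp (-(‖a‖ ^ 2 / 2 : ℝ)) *
        Complex.exp ((⟪x, t⟫ : ℝ) * Complex.I + (⟪x, a⟫ : ℝ)) := fun x => by
    rw [ENNReal.toReal_ofReal (Real.exp_pos _).le, Complex.real_smul, Complex.ofReal_exp,
      ← Complex.exp_add, ← Complex.exp_add]
    congr 1
    push_cast
    ring
  simp_rw [h1]
  rw [integral_const_mul, integral_cexp_stdGaussian, ← Complex.exp_add, ← Complex.exp_add]
  congr 1
  have h2 : ∑ j, ((t j : ℂ) * Complex.I + a j) ^ 2 / 2 =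
      -(‖t‖ ^ 2 / 2 : ℝ) + (⟪a, t⟫ : ℝ) * Complex.I + (‖a‖ ^ 2 / 2 : ℝ) := by
    rw [EuclideanSpace.real_norm_sq_eq, EuclideanSpace.real_norm_sq_eq]
    simp only [PiLp.inner_apply, RCLike.inner_apply, conj_trivial]
    push_cast
    rw [Finset.sum_mul, Finset.sum_div, Finset.sum_div, ← Finset.sum_neg_distrib,
      ← Finset.sum_add_distrib, ← Finset.sum_add_distrib]
    refine Finset.sum_congr rfl fun j _ => ?_
    have := Complex.I_sq
    linear_combination ((t j : ℂ) ^ 2 / 2) * this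
  rw [h2]
  push_cast
  ring

lemma lintegral_stdGaussian_add (a : Signal L) {f : Signal L → ENNReal} (hf : Measurable f) :
    ∫⁻ x, f (x + a) ∂(stdGaussian (Signal L)) =
      ∫⁻ x, ENNReal.ofReal (Real.exp (⟪x, a⟫ - ‖a‖ ^ 2 / 2)) * f x ∂(stdGaussian (Signal L)) := by
  rw [← lintegral_map (g := fun x => x + a) hf (measurable_id.add_const a), stdGaussian_map_add,
    lintegral_withDensity_eq_lintegral_mul _ (by fun_prop) hf]
  rfl

end GaussianShift

/-! ### Cumulant generating functions of bounded variables. -/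

section CumulantExpansion

variable {Ω : Type*} [MeasurableSpace Ω] {ν : Measure Ω} [IsProbabilityMeasure ν]

lemma integrable_of_abs_le {V : Ω → ℝ} {B : ℝ} (hV : AEStronglyMeasurable V ν)
    (hB : ∀ x, |V x| ≤ B) : Integrable V ν :=
  Integrable.of_bound hV B (ae_of_all _ fun x => by simpa using hB x)

lemma abs_integral_le_of_abs_le {V : Ω → ℝ} {B : ℝ} (hB : ∀ x, |V x| ≤ B) :
    |∫ x, V x ∂ν| ≤ B := by
  simpa using norm_integral_le_of_norm_le_const (μ := ν) (f := V) (C := B)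
    (ae_of_all _ fun x => by simpa using hB x)

lemma integrable_exp_of_abs_le {V : Ω → ℝ} {B : ℝ} (hV : AEStronglyMeasurable V ν)
    (hB : ∀ x, |V x| ≤ B) : Integrable (fun x => Real.exp (V x)) ν :=
  integrable_of_abs_le (B := Real.exp B) (Real.continuous_exp.comp_aestronglyMeasurable hV)
    fun x => by
      rw [Real.abs_exp]
      exact Real.exp_le_exp.2 ((le_abs_self _).trans (hB x))

lemma log_integral_exp_sub_le {V W : Ω → ℝ} {B D : ℝ} (hV : AEStronglyMeasurable V ν)
    (hB : ∀ x, |V x| ≤ B) (hW : AEStronglyMeasurable W ν) (hWB : ∀ x, |W x| ≤ B)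
    (hD : ∀ x, V x - W x ≤ D) :
    Real.log (∫ x, Real.exp (V x) ∂ν) - Real.log (∫ x, Real.exp (W x) ∂ν) ≤ D := by
  have hV' := integrable_exp_of_abs_le hV hB
  have hW' := integrable_exp_of_abs_le hW hWB
  have h1 : ∫ x, Real.exp (V x) ∂ν ≤ Real.exp D * ∫ x, Real.exp (W x) ∂ν := by
    rw [← integral_const_mul]
    refine integral_mono hV' (hW'.const_mul _) fun x => ?_
    simp only
    rw [← Real.exp_add]
    exact Real.exp_le_exp.2 (by linarith [hD x])
  have h2 := Real.log_le_log (integral_exp_pos hV') h1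
  rw [Real.log_mul (Real.exp_pos _).ne' (integral_exp_pos hW').ne', Real.log_exp] at h2
  linarith

lemma abs_log_integral_exp_le {V : Ω → ℝ} {B : ℝ} (hV : AEStronglyMeasurable V ν)
    (hB : ∀ x, |V x| ≤ B) : |Real.log (∫ x, Real.exp (V x) ∂ν)| ≤ B := by
  have h0 : AEStronglyMeasurable (fun _ : Ω => (0 : ℝ)) ν := aestronglyMeasurable_const
  have hz : ∀ x : Ω, |(fun _ : Ω => (0 : ℝ)) x| ≤ B := fun x => by
    simpa using (abs_nonneg _).trans (hB x)
  have h1 := log_integral_exp_sub_le (D := B) hV hB h0 hz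
    fun x => by simpa using (le_abs_self _).trans (hB x)
  have h2 := log_integral_exp_sub_le (D := B) h0 hz hV hB
    fun x => by simpa using (neg_le_abs _).trans (hB x)
  simp only [Real.exp_zero, integral_const, probReal_univ, smul_eq_mul, mul_one,
    Real.log_one] at h1 h2
  exact abs_le.2 ⟨by linarith, by linarith⟩

/-- Second order expansion of the cumulant generating function of a bounded variable. -/
lemma abs_log_integral_exp_sub_le {V : Ω → ℝ} {B : ℝ} (hV : AEStronglyMeasurable V ν)
    (hB : ∀ x, |V x| ≤ B) :
    |Real.log (∫ x, Real.exp (V x) ∂ν) - (∫ x, V x ∂ν +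
      (∫ x, V x ^ 2 ∂ν - (∫ x, V x ∂ν) ^ 2) / 2)| ≤ 40 * B ^ 3 := by
  have hne : Nonempty Ω := nonempty_of_isProbabilityMeasure ν
  have hB0 : 0 ≤ B := (abs_nonneg _).trans (hB hne.some)
  have hV2B : ∀ x, |V x ^ 2| ≤ B ^ 2 := fun x => by
    rw [abs_pow]; exact pow_le_pow_left₀ (abs_nonneg _) (hB x) 2
  have hI := integrable_of_abs_le hV hB
  have hI2 : Integrable (fun x => V x ^ 2) ν := integrable_of_abs_le (hV.pow 2) hV2B
  have hE := integrable_exp_of_abs_le hV hB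
  have hm := abs_integral_le_of_abs_le (ν := ν) hB
  have hq := abs_integral_le_of_abs_le (ν := ν) hV2B
  have hq0 : 0 ≤ ∫ x, V x ^ 2 ∂ν := integral_nonneg fun x => sq_nonneg _
  set m := ∫ x, V x ∂ν with hmdef
  set q := ∫ x, V x ^ 2 ∂ν with hqdef
  have hm2 : m ^ 2 ≤ B ^ 2 := by
    rw [← sq_abs]; exact pow_le_pow_left₀ (abs_nonneg _) hm 2
  rw [abs_of_nonneg hq0] at hq
  -- For small `B`, Taylor expansions of `exp` and `log` apply. For `B > 1/4` each term is trivially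
  -- bounded and `40 * B ^ 3` dominates their sum.
  rcases le_or_gt B (1 / 4) with hB4 | hB4
  · have h3 : |∫ x, Real.exp (V x) ∂ν - (1 + m + q / 2)| ≤ B ^ 3 / 4 := by
      have : ∫ x, Real.exp (V x) ∂ν - (1 + m + q / 2) =
          ∫ x, (Real.exp (V x) - (1 + V x + V x ^ 2 / 2)) ∂ν := by
        have i1 : Integrable (fun x => 1 + V x) ν := (integrable_const _).add hI
        have i2 : Integrable (fun x => V x ^ 2 / 2) ν := hI2.div_const 2
        have i3 : Integrable (fun x => 1 + V x + V x ^ 2 / 2) ν := i1.add i2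
        rw [integral_sub hE i3, integral_add i1 i2, integral_add (integrable_const _) hI,
          integral_div]
        simp [hmdef, hqdef]
      rw [this]
      refine abs_integral_le_of_abs_le fun x => ?_
      have h := Real.exp_bound ((hB x).trans (hB4.trans (by norm_num))) (n := 3) (by norm_num)
      simp only [Finset.sum_range_succ, Finset.sum_range_zero] at h
      norm_num [Nat.factorial] at h
      refine h.trans ?_
      have := pow_le_pow_left₀ (abs_nonneg _) (hB x) 3
      nlinarith [pow_nonneg hB0 3]
    set u := ∫ x, Real.exp (V x) ∂ν - 1 with hu
    -- With `u = E exp V - 1`, `e` is the error of the first order approximation of `u`, and `r`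
    -- that of the second order one.
    obtain ⟨e, he⟩ : ∃ e, e = u - m := ⟨_, rfl⟩
    obtain ⟨r, hr⟩ : ∃ r, r = u - (m + q / 2) := ⟨_, rfl⟩
    have hrb : |r| ≤ B ^ 3 / 4 := by rw [hr, hu]; convert h3 using 2; ring
    have hBB : B ^ 3 ≤ B ^ 2 / 4 := by nlinarith [sq_nonneg B]
    have hB2 : B ^ 2 ≤ B / 4 := by nlinarith
    have hrb' := abs_le.1 hrb
    have heb : |e| ≤ B ^ 2 := abs_le.2 ⟨by rw [he]; linarith, by rw [he]; linarith⟩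
    have hub : |u| ≤ 2 * B := by
      have : u = m + e := by rw [he]; ring
      rw [this]
      exact (abs_add_le _ _).trans (by linarith)
    have hlog := Real.abs_log_sub_add_sum_range_le (x := -u) (by rw [abs_neg]; linarith) 2
    simp only [Finset.sum_range_succ, Finset.sum_range_zero, abs_neg] at hlog
    norm_num at hlog
    have hlog2 : |u| ^ 3 / (1 - |u|) ≤ 16 * B ^ 3 := by
      rw [div_le_iff₀ (by linarith)]
      have h1 := pow_le_pow_left₀ (abs_nonneg _) hub 3
      have h2 : (1 : ℝ) / 2 ≤ 1 - |u| := by linarith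
      nlinarith [pow_nonneg hB0 3, mul_le_mul_of_nonneg_left h2 (pow_nonneg hB0 3)]
    have hu1 : ∫ x, Real.exp (V x) ∂ν = 1 + u := by rw [hu]; ring
    rw [hu1]
    have hdec : Real.log (1 + u) - (m + (q - m ^ 2) / 2) =
        (-u + u ^ 2 / 2 + Real.log (1 + u)) + r - (m * e + e ^ 2 / 2) := by
      rw [hr, he]; ring
    rw [hdec]
    have hme : |m * e + e ^ 2 / 2| ≤ 2 * B ^ 3 := by
      refine (abs_add_le _ _).trans ?_
      rw [abs_mul, abs_div, abs_pow]
      have h1 : |m| * |e| ≤ B * B ^ 2 := mul_le_mul hm heb (abs_nonneg _) hB0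
      have h2 : |e| ^ 2 ≤ (B ^ 2) ^ 2 := pow_le_pow_left₀ (abs_nonneg _) heb 2
      have h3 : (B ^ 2) ^ 2 ≤ B ^ 3 := by nlinarith [pow_nonneg hB0 3]
      norm_num
      nlinarith [pow_nonneg hB0 3]
    refine (abs_sub _ _).trans ?_
    refine (add_le_add (abs_add_le _ _) le_rfl).trans ?_
    have := pow_nonneg hB0 3
    linarith [hlog.trans hlog2]
  · have h1 := abs_log_integral_exp_le hV hB
    have h4 : |m + (q - m ^ 2) / 2| ≤ B + B ^ 2 / 2 := by
      have := abs_le.1 hm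
      exact abs_le.2 ⟨by nlinarith [sq_nonneg m], by nlinarith [sq_nonneg m]⟩
    refine (abs_sub _ _).trans ?_
    have h5 : B ^ 2 ≤ 4 * B ^ 3 := by nlinarith [sq_nonneg B]
    have h6 : B ≤ 4 * B ^ 2 := by nlinarith
    linarith

end CumulantExpansion

/-! ### Densities, the posterior on the group, and Bayes' rule at unit noise. -/

section Model

variable {L : ℕ} (G : Subgroup (O L)) [CompactSpace G]

instance instIsProbabilityMeasureLaw (σ : ℝ) (θ : Signal L) :
    IsProbabilityMeasure (law G σ θ) :=
  Measure.isProbabilityMeasure_map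
    ((((continuous_act_left G θ).measurable.comp measurable_fst).add
      (measurable_snd.const_smul σ)).aemeasurable)

/-- The normalized likelihood `E_g exp ⟨y, g φ⟩` at unit noise level. -/
def lik (y φ : Signal L) : ℝ := ∫ g : G, Real.exp ⟪y, act (g : O L) φ⟫ ∂(unif G)

/-- The log-density of `P_φ` with respect to the standard Gaussian at unit noise level. -/
def ell (y φ : Signal L) : ℝ := Real.log (lik G y φ) - ‖φ‖ ^ 2 / 2

/-- The posterior distribution of the group element given the observation `y`. -/
def post (θ y : Signal L) : Measure G := (unif G).tilted fun g => ⟪y, act (g : O L) θ⟫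

/-- The joint law of the group element and the observation, at unit noise level. -/
def joint (θ : Signal L) : Measure (G × Signal L) :=
  ((unif G).prod (stdGaussian (Signal L))).map fun p => (p.1, act (p.1 : O L) θ + p.2)

lemma abs_inner_act_le (y φ : Signal L) (g : O L) : |⟪y, act g φ⟫| ≤ ‖y‖ * ‖φ‖ := by
  simpa [norm_act] using abs_real_inner_le_norm y (act g φ)

lemma continuous_inner_act (θ : Signal L) :
    Continuous fun p : G × Signal L => (⟪p.2, act (p.1 : O L) θ⟫ : ℝ) :=
  continuous_snd.inner ((continuous_act_left G θ).comp continuous_fst)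

lemma continuous_inner_act_left (y θ : Signal L) :
    Continuous fun g : G => (⟪y, act (g : O L) θ⟫ : ℝ) :=
  continuous_const.inner (continuous_act_left G θ)

lemma integrable_exp_inner_act (y φ : Signal L) :
    Integrable (fun g : G => Real.exp ⟪y, act (g : O L) φ⟫) (unif G) :=
  integrable_exp_of_abs_le (continuous_inner_act_left G y φ).aestronglyMeasurable
    fun g => abs_inner_act_le y φ g

lemma lik_pos (y φ : Signal L) : 0 < lik G y φ := integral_exp_pos (integrable_exp_inner_act G y φ)

lemma lik_act (y φ : Signal L) (h : G) : lik G y (act (h : O L) φ) = lik G y φ := by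
  unfold lik
  rw [← integral_unif_mul_right G h fun g => Real.exp ⟪y, act (g : O L) φ⟫]
  simp [act_mul]

lemma ell_act (y φ : Signal L) (h : G) : ell G y (act (h : O L) φ) = ell G y φ := by
  simp [ell, lik_act, norm_act]

lemma measurable_lik (φ : Signal L) : Measurable fun y => lik G y φ := by
  have : StronglyMeasurable fun p : G × Signal L => Real.exp ⟪p.2, act (p.1 : O L) φ⟫ :=
    (Real.continuous_exp.comp (continuous_inner_act G φ)).measurable.stronglyMeasurable
  exact this.integral_prod_left.measurable

lemma measurable_ell (φ : Signal L) : Measurable fun y => ell G y φ :=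
  (Real.measurable_log.comp (measurable_lik G φ)).sub_const _

lemma exp_ell (y φ : Signal L) :
    Real.exp (ell G y φ) = ∫ g : G, Real.exp (⟪y, act (g : O L) φ⟫ - ‖φ‖ ^ 2 / 2) ∂(unif G) := by
  simp_rw [ell, Real.exp_sub, Real.exp_log (lik_pos G y φ), integral_div]
  rfl

instance instIsProbabilityMeasurePost (θ y : Signal L) : IsProbabilityMeasure (post G θ y) :=
  isProbabilityMeasure_tilted (integrable_exp_inner_act G y θ)

lemma measurable_joint_map (θ : Signal L) :
    Measurable fun p : G × Signal L => (p.1, act (p.1 : O L) θ + p.2) :=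
  measurable_fst.prodMk
    (((continuous_act_left G θ).measurable.comp measurable_fst).add measurable_snd)

lemma law_one (θ : Signal L) : law G 1 θ = (joint G θ).map Prod.snd := by
  rw [joint, Measure.map_map measurable_snd (measurable_joint_map G θ), law]
  simp [Function.comp_def]

/-- Given `g`, the observation is a Gaussian shifted by `act g θ`, so Cameron-Martin applies
fibrewise; the normalizing constant is free of `g` because the action is isometric. -/
lemma joint_eq (θ : Signal L) : joint G θ = ((unif G).prod (stdGaussian (Signal L))).withDensity
    fun p => ENNReal.ofReal (Real.exp (⟪p.2, act (p.1 : O L) θ⟫ - ‖θ‖ ^ 2 / 2)) := by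
  have hw : Measurable fun p : G × Signal L =>
      ENNReal.ofReal (Real.exp (⟪p.2, act (p.1 : O L) θ⟫ - ‖θ‖ ^ 2 / 2)) :=
    ENNReal.measurable_ofReal.comp
      (Real.measurable_exp.comp ((continuous_inner_act G θ).measurable.sub_const _))
  refine Measure.ext_of_lintegral _ fun f hf => ?_
  have hf' : Measurable fun p : G × Signal L => f (p.1, act (p.1 : O L) θ + p.2) :=
    hf.comp (measurable_joint_map G θ)
  rw [joint, lintegral_map hf (measurable_joint_map G θ),
    lintegral_withDensity_eq_lintegral_mul _ hw hf,
    lintegral_prod _ hf'.aemeasurable,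
    lintegral_prod _ (hw.mul hf).aemeasurable]
  refine lintegral_congr fun g => ?_
  have := lintegral_stdGaussian_add (act (g : O L) θ) (f := fun x => f (g, x))
    (hf.comp measurable_prodMk_left)
  simp only [norm_act] at this
  simpa [add_comm] using this

lemma lintegral_exp_inner_act (θ y : Signal L) :
    ∫⁻ g : G, ENNReal.ofReal (Real.exp (⟪y, act (g : O L) θ⟫ - ‖θ‖ ^ 2 / 2)) ∂(unif G) =
      ENNReal.ofReal (Real.exp (ell G y θ)) := by
  rw [exp_ell, ofReal_integral_eq_lintegral_ofReal _ (ae_of_all _ fun g => (Real.exp_pos _).le)]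
  simp_rw [Real.exp_sub]
  exact (integrable_exp_inner_act G y θ).div_const _

lemma law_one_eq (θ : Signal L) : law G 1 θ = (stdGaussian (Signal L)).withDensity
    fun y => ENNReal.ofReal (Real.exp (ell G y θ)) := by
  have hw : Measurable fun p : G × Signal L =>
      ENNReal.ofReal (Real.exp (⟪p.2, act (p.1 : O L) θ⟫ - ‖θ‖ ^ 2 / 2)) :=
    ENNReal.measurable_ofReal.comp
      (Real.measurable_exp.comp ((continuous_inner_act G θ).measurable.sub_const _))
  have he : Measurable fun y => ENNReal.ofReal (Real.exp (ell G y θ)) :=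
    ENNReal.measurable_ofReal.comp (Real.measurable_exp.comp (measurable_ell G θ))
  refine Measure.ext_of_lintegral _ fun f hf => ?_
  have hf' : Measurable fun p : G × Signal L => f p.2 := hf.comp measurable_snd
  have h1 : ∫⁻ y, f y ∂(law G 1 θ) = ∫⁻ p : G × Signal L,
      ENNReal.ofReal (Real.exp (⟪p.2, act (p.1 : O L) θ⟫ - ‖θ‖ ^ 2 / 2)) * f p.2
        ∂((unif G).prod (stdGaussian (Signal L))) := by
    rw [law_one, lintegral_map hf measurable_snd, joint_eq]
    exact lintegral_withDensity_eq_lintegral_mul _ hw hf'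
  have h2 : ∫⁻ y, f y ∂((stdGaussian (Signal L)).withDensity
      fun y => ENNReal.ofReal (Real.exp (ell G y θ))) =
      ∫⁻ y, ENNReal.ofReal (Real.exp (ell G y θ)) * f y ∂(stdGaussian (Signal L)) :=
    lintegral_withDensity_eq_lintegral_mul _ he hf
  have hwf : Measurable fun p : G × Signal L =>
      ENNReal.ofReal (Real.exp (⟪p.2, act (p.1 : O L) θ⟫ - ‖θ‖ ^ 2 / 2)) * f p.2 := hw.mul hf'
  rw [h1, h2, lintegral_prod_symm _ hwf.aemeasurable]
  refine lintegral_congr fun y => ?_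
  have hwy : Measurable fun g : G =>
      ENNReal.ofReal (Real.exp (⟪y, act (g : O L) θ⟫ - ‖θ‖ ^ 2 / 2)) :=
    ENNReal.measurable_ofReal.comp
      (Real.measurable_exp.comp ((continuous_inner_act_left G y θ).measurable.sub_const _))
  rw [← lintegral_exp_inner_act]
  exact lintegral_mul_const (f y) hwy

lemma integral_law_one (θ : Signal L) (F : Signal L → ℝ) :
    ∫ y, F y ∂(law G 1 θ) = ∫ y, Real.exp (ell G y θ) * F y ∂(stdGaussian (Signal L)) := by
  have he : Measurable fun y => ENNReal.ofReal (Real.exp (ell G y θ)) :=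
    ENNReal.measurable_ofReal.comp (Real.measurable_exp.comp (measurable_ell G θ))
  rw [law_one_eq, integral_withDensity_eq_integral_toReal_smul he (by simp)]
  simp [ENNReal.toReal_ofReal (Real.exp_pos _).le]

/-- Bayes' rule: averaging the posterior expectation gives the joint expectation. -/
lemma integral_integral_post (θ : Signal L) {F : G × Signal L → ℝ}
    (hF : Integrable F (joint G θ)) :
    ∫ y, ∫ g, F (g, y) ∂(post G θ y) ∂(law G 1 θ) = ∫ p, F p ∂(joint G θ) := by
  have hw : Measurable fun p : G × Signal L =>
      ENNReal.ofReal (Real.exp (⟪p.2, act (p.1 : O L) θ⟫ - ‖θ‖ ^ 2 / 2)) :=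
    ENNReal.measurable_ofReal.comp
      (Real.measurable_exp.comp ((continuous_inner_act G θ).measurable.sub_const _))
  have hF' := hF
  rw [joint_eq, integrable_withDensity_iff_integrable_smul' hw (by simp)] at hF'
  rw [joint_eq, integral_withDensity_eq_integral_toReal_smul hw (by simp),
    integral_prod_symm _ hF', integral_law_one]
  refine integral_congr_ae (ae_of_all _ fun y => ?_)
  simp only [post]
  rw [integral_tilted, ← integral_const_mul]
  refine integral_congr_ae (ae_of_all _ fun g => ?_)
  simp only [smul_eq_mul, ENNReal.toReal_ofReal (Real.exp_pos _).le]
  have := (lik_pos G y θ).ne'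
  rw [show (∫ x : G, Real.exp ⟪y, act (x : O L) θ⟫ ∂(unif G)) = lik G y θ from rfl, ell,
    Real.exp_sub, Real.exp_sub, Real.exp_log (lik_pos G y θ)]
  field_simp

lemma measurable_integral_post (θ : Signal L) {F : G × Signal L → ℝ} (hF : Measurable F) :
    Measurable fun y => ∫ g, F (g, y) ∂(post G θ y) := by
  simp only [post, integral_tilted]
  have : StronglyMeasurable fun p : G × Signal L =>
      (Real.exp ⟪p.2, act (p.1 : O L) θ⟫ / lik G p.2 θ) • F p :=
    (((Real.continuous_exp.comp (continuous_inner_act G θ)).measurable.div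
      ((measurable_lik G θ).comp measurable_snd)).smul hF).stronglyMeasurable
  exact this.integral_prod_left.measurable

lemma integral_joint (θ : Signal L) {F : G × Signal L → ℝ} (hF : Measurable F) :
    ∫ p, F p ∂(joint G θ) =
      ∫ p, F (p.1, act (p.1 : O L) θ + p.2) ∂((unif G).prod (stdGaussian (Signal L))) := by
  rw [joint, integral_map (measurable_joint_map G θ).aemeasurable hF.aestronglyMeasurable]

lemma integrable_joint_iff (θ : Signal L) {F : G × Signal L → ℝ} (hF : Measurable F) :
    Integrable F (joint G θ) ↔ Integrable (fun p : G × Signal L => F (p.1, act (p.1 : O L) θ + p.2))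
      ((unif G).prod (stdGaussian (Signal L))) := by
  rw [joint, integrable_map_measure hF.aestronglyMeasurable
    (measurable_joint_map G θ).aemeasurable]
  rfl

lemma norm_act_add_le {θ : Signal L} (hθ : ‖θ‖ ≤ 1) (g : O L) (x : Signal L) :
    ‖act g θ + x‖ ≤ 1 + ‖x‖ := by
  have := norm_add_le (act g θ) x
  rw [norm_act] at this
  linarith

/-- Domination of moments of the observation by Gaussian moments. -/
lemma integrable_law_of_monotone {θ : Signal L} (hθ : ‖θ‖ ≤ 1) {h : ℝ → ℝ} (hc : Continuous h)
    (hm : MonotoneOn h (Set.Ici 0)) (h0 : ∀ x, 0 ≤ x → 0 ≤ h x)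
    (hi : Integrable (fun x : Signal L => h (1 + ‖x‖)) (stdGaussian (Signal L))) :
    Integrable (fun y => h ‖y‖) (law G 1 θ) ∧
      ∫ y, h ‖y‖ ∂(law G 1 θ) ≤ ∫ x, h (1 + ‖x‖) ∂(stdGaussian (Signal L)) := by
  have hmeas : Measurable fun p : G × Signal L => act (p.1 : O L) θ + p.2 :=
    ((continuous_act_left G θ).measurable.comp measurable_fst).add measurable_snd
  have hlaw : law G 1 θ = ((unif G).prod (stdGaussian (Signal L))).map
      (fun p => act (p.1 : O L) θ + p.2) := by simp [law]
  have hhm : Measurable fun y : Signal L => h ‖y‖ := (hc.comp continuous_norm).measurable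
  have hle : ∀ p : G × Signal L, h ‖act (p.1 : O L) θ + p.2‖ ≤ h (1 + ‖p.2‖) := fun p =>
    hm (norm_nonneg _) (by positivity : (0 : ℝ) ≤ 1 + ‖p.2‖) (norm_act_add_le hθ _ _)
  have hi' : Integrable (fun p : G × Signal L => h (1 + ‖p.2‖))
      ((unif G).prod (stdGaussian (Signal L))) := hi.comp_snd (unif G)
  have h1 : Integrable (fun p : G × Signal L => h ‖act (p.1 : O L) θ + p.2‖)
      ((unif G).prod (stdGaussian (Signal L))) :=
    hi'.mono' (hhm.comp hmeas).aestronglyMeasurable (ae_of_all _ fun p => by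
      rw [Real.norm_of_nonneg (h0 _ (norm_nonneg _))]
      exact hle p)
  rw [hlaw]
  refine ⟨(integrable_map_measure hhm.aestronglyMeasurable hmeas.aemeasurable).2 h1, ?_⟩
  rw [integral_map hmeas.aemeasurable hhm.aestronglyMeasurable]
  refine (integral_mono h1 hi' hle).trans_eq ?_
  rw [integral_prod _ hi']
  simp

end Model

/-! ### Score, posterior covariance and increments of the log-likelihood. -/

section Likelihood

variable {L : ℕ} (G : Subgroup (O L)) [CompactSpace G]

/-- The centred linear statistic `⟨y, g δ⟩ - ⟨θ, δ⟩`, linear in `δ`. -/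
def lin (θ : Signal L) (p : G × Signal L) : Signal L →ₗ[ℝ] ℝ where
  toFun δ := ⟪p.2, act (p.1 : O L) δ⟫ - ⟪θ, δ⟫
  map_add' δ δ' := by simp only [act_add, inner_add_right]; ring
  map_smul' a δ := by simp only [act_smul, inner_smul_right, RingHom.id_apply, smul_eq_mul]; ring

lemma lin_apply (θ δ : Signal L) (p : G × Signal L) :
    lin G θ p δ = ⟪p.2, act (p.1 : O L) δ⟫ - ⟪θ, δ⟫ := rfl

lemma continuous_lin (θ δ : Signal L) : Continuous fun p : G × Signal L => lin G θ p δ :=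
  (continuous_inner_act G δ).sub continuous_const

lemma continuous_lin_left (θ δ y : Signal L) : Continuous fun g : G => lin G θ (g, y) δ :=
  (continuous_lin G θ δ).comp (continuous_id.prodMk continuous_const)

variable {θ : Signal L} (hθ : ‖θ‖ ≤ 1)

include hθ in
lemma abs_lin_le (p : G × Signal L) (δ : Signal L) : |lin G θ p δ| ≤ (1 + ‖p.2‖) * ‖δ‖ := by
  rw [lin_apply]
  refine (abs_sub _ _).trans ?_
  have h1 := abs_inner_act_le p.2 δ (p.1 : O L)
  have h2 := (abs_real_inner_le_norm θ δ).trans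
    (mul_le_mul_of_nonneg_right hθ (norm_nonneg δ))
  linarith

include hθ in
lemma integrable_lin (δ y : Signal L) (ν : Measure G) [IsProbabilityMeasure ν] :
    Integrable (fun g => lin G θ (g, y) δ) ν :=
  integrable_of_abs_le (B := (1 + ‖y‖) * ‖δ‖) (continuous_lin_left G θ δ y).aestronglyMeasurable
    fun g => abs_lin_le G hθ (g, y) δ

include hθ in
lemma integrable_lin_mul_lin (δ δ' y : Signal L) (ν : Measure G) [IsProbabilityMeasure ν] :
    Integrable (fun g => lin G θ (g, y) δ * lin G θ (g, y) δ') ν :=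
  integrable_of_abs_le (B := ((1 + ‖y‖) * ‖δ‖) * ((1 + ‖y‖) * ‖δ'‖))
    ((continuous_lin_left G θ δ y).mul (continuous_lin_left G θ δ' y)).aestronglyMeasurable
    fun g => by
      rw [abs_mul]
      exact mul_le_mul (abs_lin_le G hθ (g, y) δ) (abs_lin_le G hθ (g, y) δ') (abs_nonneg _)
        (by positivity)

/-- The score `∇_θ log p_θ(y)`, as a linear form. -/
def score (hθ : ‖θ‖ ≤ 1) (y : Signal L) : Signal L →ₗ[ℝ] ℝ where
  toFun δ := ∫ g, lin G θ (g, y) δ ∂(post G θ y)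
  map_add' δ δ' := by
    simp only [map_add]
    exact integral_add (integrable_lin G hθ δ y _) (integrable_lin G hθ δ' y _)
  map_smul' a δ := by
    simp only [map_smul, smul_eq_mul, RingHom.id_apply]
    exact integral_const_mul _ _

lemma score_apply (y δ : Signal L) :
    score G hθ y δ = ∫ g, lin G θ (g, y) δ ∂(post G θ y) := rfl

/-- The posterior covariance of the linear statistic in the directions `δ`, `δ'`. -/
def postCov (hθ : ‖θ‖ ≤ 1) (y δ δ' : Signal L) : ℝ :=
  ∫ g, lin G θ (g, y) δ * lin G θ (g, y) δ' ∂(post G θ y) - score G hθ y δ * score G hθ y δ'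

lemma abs_score_le (y δ : Signal L) : |score G hθ y δ| ≤ (1 + ‖y‖) * ‖δ‖ :=
  abs_integral_le_of_abs_le fun g => abs_lin_le G hθ (g, y) δ

lemma measurable_score (δ : Signal L) : Measurable fun y => score G hθ y δ :=
  measurable_integral_post G θ (continuous_lin G θ δ).measurable

lemma measurable_postCov (δ δ' : Signal L) : Measurable fun y => postCov G hθ y δ δ' :=
  (measurable_integral_post G θ (F := fun p => lin G θ p δ * lin G θ p δ')
    ((continuous_lin G θ δ).mul (continuous_lin G θ δ')).measurable).sub
    ((measurable_score G hθ δ).mul (measurable_score G hθ δ'))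

lemma abs_postCov_le (y δ δ' : Signal L) :
    |postCov G hθ y δ δ'| ≤ 2 * ((1 + ‖y‖) ^ 2 * ‖δ‖ * ‖δ'‖) := by
  have h1 : |∫ g, lin G θ (g, y) δ * lin G θ (g, y) δ' ∂(post G θ y)| ≤
      ((1 + ‖y‖) * ‖δ‖) * ((1 + ‖y‖) * ‖δ'‖) := abs_integral_le_of_abs_le fun g => by
    rw [abs_mul]
    exact mul_le_mul (abs_lin_le G hθ (g, y) δ) (abs_lin_le G hθ (g, y) δ') (abs_nonneg _)
      (by positivity)
  have h2 : |score G hθ y δ * score G hθ y δ'| ≤ ((1 + ‖y‖) * ‖δ‖) * ((1 + ‖y‖) * ‖δ'‖) := by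
    rw [abs_mul]
    exact mul_le_mul (abs_score_le G hθ y δ) (abs_score_le G hθ y δ') (abs_nonneg _)
      (by positivity)
  refine (abs_sub _ _).trans ((add_le_add h1 h2).trans_eq ?_)
  ring

lemma eq_sum_single (δ : Signal L) : δ = ∑ j, δ j • EuclideanSpace.single j (1 : ℝ) := by
  have := (EuclideanSpace.basisFun (Fin L) ℝ).sum_repr δ
  simpa using this.symm

/-- Bilinearity reduces control over all directions to finitely many entries. -/
lemma postCov_eq_sum (y δ : Signal L) : postCov G hθ y δ δ =
    ∑ j, ∑ k, δ j * δ k * postCov G hθ y (EuclideanSpace.single j 1) (EuclideanSpace.single k 1) := by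
  have hl : ∀ f : Signal L →ₗ[ℝ] ℝ, f δ * f δ = ∑ j, ∑ k, δ j * δ k *
      (f (EuclideanSpace.single j 1) * f (EuclideanSpace.single k 1)) := fun f => by
    have : f δ = ∑ j, δ j * f (EuclideanSpace.single j 1) := by
      conv_lhs => rw [eq_sum_single δ]
      simp
    rw [this, Finset.sum_mul_sum]
    exact Finset.sum_congr rfl fun j _ => Finset.sum_congr rfl fun k _ => by ring
  unfold postCov
  simp_rw [mul_sub, Finset.sum_sub_distrib]
  rw [hl (score G hθ y)]
  congr 1
  simp_rw [hl]
  rw [integral_finsetSum _ fun j _ => integrable_finsetSum _ fun k _ =>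
    (integrable_lin_mul_lin G hθ _ _ y _).const_mul _]
  refine Finset.sum_congr rfl fun j _ => ?_
  rw [integral_finsetSum _ fun k _ => (integrable_lin_mul_lin G hθ _ _ y _).const_mul _]
  exact Finset.sum_congr rfl fun k _ => integral_const_mul _ _

/-- The increment of the log-likelihood in direction `δ`. -/
def incr (θ δ y : Signal L) : ℝ := ell G y (θ + δ) - ell G y θ

lemma measurable_incr (θ δ : Signal L) : Measurable fun y => incr G θ δ y :=
  (measurable_ell G _).sub (measurable_ell G _)

/-- The ratio of likelihoods at `θ + δ` and `θ` is a posterior expectation of `exp ⟪y, g δ⟫`. The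
centring in `lin` absorbs the cross term `⟪θ, δ⟫` of `‖θ + δ‖²`, leaving only `‖δ‖² / 2`. -/
lemma incr_eq (θ δ y : Signal L) :
    incr G θ δ y = Real.log (∫ g, Real.exp (lin G θ (g, y) δ) ∂(post G θ y)) - ‖δ‖ ^ 2 / 2 := by
  have h1 : ∫ g, Real.exp (lin G θ (g, y) δ) ∂(post G θ y) =
      lik G y (θ + δ) / lik G y θ * Real.exp (-⟪θ, δ⟫) := by
    rw [post, integral_tilted]
    rw [show (∫ x : G, Real.exp ⟪y, act (x : O L) θ⟫ ∂(unif G)) = lik G y θ from rfl]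
    conv_rhs => rw [lik, ← integral_div, ← integral_mul_const]
    refine integral_congr_ae (ae_of_all _ fun g => ?_)
    simp only [lin_apply, act_add, inner_add_right, smul_eq_mul, sub_eq_add_neg, Real.exp_add]
    ring
  rw [h1, Real.log_mul (div_pos (lik_pos G _ _) (lik_pos G _ _)).ne' (Real.exp_pos _).ne',
    Real.log_div (lik_pos G _ _).ne' (lik_pos G _ _).ne', Real.log_exp, incr, ell, ell,
    norm_add_sq_real]
  ring

-- This Lipschitz bound serves both to discretize the parameter and, with `δ' = 0`, to bound single
-- increments.
include hθ in
lemma incr_sub_incr_le (δ δ' y : Signal L) : incr G θ δ y - incr G θ δ' y ≤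
    (1 + ‖y‖ + ‖δ‖ + ‖δ'‖) * ‖δ - δ'‖ := by
  rw [incr_eq, incr_eq]
  have hM : ∀ e : Signal L, ∀ g, |lin G θ (g, y) e| ≤ (1 + ‖y‖) * ‖e‖ := fun e g =>
    abs_lin_le G hθ (g, y) e
  have h1 := log_integral_exp_sub_le (ν := post G θ y) (B := (1 + ‖y‖) * (‖δ‖ + ‖δ'‖))
    (D := (1 + ‖y‖) * ‖δ - δ'‖)
    (continuous_lin_left G θ δ y).aestronglyMeasurable
    (fun g => (hM δ g).trans (by gcongr; linarith [norm_nonneg δ']))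
    (continuous_lin_left G θ δ' y).aestronglyMeasurable
    (fun g => (hM δ' g).trans (by gcongr; linarith [norm_nonneg δ]))
    (fun g => by rw [← map_sub]; exact (le_abs_self _).trans (hM _ g))
  have h2 : ‖δ'‖ ^ 2 - ‖δ‖ ^ 2 ≤ (‖δ‖ + ‖δ'‖) * ‖δ - δ'‖ := by
    have := norm_sub_norm_le δ' δ
    rw [norm_sub_rev] at this
    nlinarith [norm_nonneg δ, norm_nonneg δ', norm_nonneg (δ - δ')]
  have h3 : 0 ≤ (‖δ‖ + ‖δ'‖) * ‖δ - δ'‖ := by positivity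
  nlinarith

lemma incr_zero (θ y : Signal L) : incr G θ 0 y = 0 := by simp [incr]

include hθ in
lemma abs_incr_le (δ y : Signal L) : |incr G θ δ y| ≤ (1 + ‖y‖ + ‖δ‖) * ‖δ‖ := by
  have h1 := incr_sub_incr_le G hθ δ 0 y
  have h2 := incr_sub_incr_le G hθ 0 δ y
  simp only [incr_zero, norm_zero, sub_zero, zero_sub, norm_neg, add_zero] at h1 h2
  exact abs_le.2 ⟨by linarith, h1⟩

lemma abs_incr_sub_expansion_le (δ y : Signal L) :
    |incr G θ δ y - (score G hθ y δ + postCov G hθ y δ δ / 2 - ‖δ‖ ^ 2 / 2)| ≤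
      40 * ((1 + ‖y‖) ^ 3 * ‖δ‖ ^ 3) := by
  have h := abs_log_integral_exp_sub_le (ν := post G θ y) (B := (1 + ‖y‖) * ‖δ‖)
    (continuous_lin_left G θ δ y).aestronglyMeasurable (fun g => abs_lin_le G hθ (g, y) δ)
  rw [mul_pow] at h
  rw [incr_eq, postCov, score_apply]
  refine le_trans (le_of_eq ?_) h
  congr 1
  simp only [sq]
  ring

end Likelihood

/-! ### Divergence as expected increment, and reduction to unit noise. -/

section Scaling

variable {L : ℕ} (G : Subgroup (O L)) [CompactSpace G]

lemma abs_log_lik_le (y φ : Signal L) : |Real.log (lik G y φ)| ≤ ‖y‖ * ‖φ‖ :=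
  abs_log_integral_exp_le (ν := unif G) (B := ‖y‖ * ‖φ‖)
    (continuous_inner_act_left G y φ).aestronglyMeasurable fun g => abs_inner_act_le y φ g

lemma abs_ell_le (y φ : Signal L) : |ell G y φ| ≤ ‖y‖ * ‖φ‖ + ‖φ‖ ^ 2 / 2 := by
  refine (abs_sub _ _).trans (add_le_add (abs_log_lik_le G y φ) (le_of_eq ?_))
  exact abs_of_nonneg (by positivity)

lemma ell_zero (y : Signal L) : ell G y 0 = 0 := by
  have h := abs_ell_le G y 0
  simpa using h

lemma integrable_norm_stdGaussian_pow (m : ℕ) (a : ℝ) :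
    Integrable (fun x : Signal L => (a + ‖x‖) ^ m) (stdGaussian (Signal L)) := by
  have h : MemLp (fun x : Signal L => a + ‖x‖) m (stdGaussian (Signal L)) := by
    have h1 : MemLp (id : Signal L → Signal L) m (stdGaussian (Signal L)) :=
      IsGaussian.memLp_id _ _ (by simp)
    exact (memLp_const a).add h1.norm
  refine (integrable_norm_iff (by fun_prop)).1 ?_
  simpa only [norm_pow] using h.integrable_norm_pow'

lemma integrable_norm_law {θ : Signal L} (hθ : ‖θ‖ ≤ 1) :
    Integrable (fun y => ‖y‖) (law G 1 θ) := by
  refine (integrable_law_of_monotone G hθ (h := fun x => x) continuous_id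
    (fun x _ y _ h => h) (fun x h => h) ?_).1
  simpa using integrable_norm_stdGaussian_pow (L := L) 1 1

lemma integrable_ell {θ : Signal L} (hθ : ‖θ‖ ≤ 1) (φ : Signal L) :
    Integrable (fun y => ell G y φ) (law G 1 θ) :=
  (((integrable_norm_law G hθ).mul_const ‖φ‖).add (integrable_const (‖φ‖ ^ 2 / 2))).mono'
    (measurable_ell G φ).aestronglyMeasurable (ae_of_all _ fun y => abs_ell_le G y φ)

lemma integrable_incr {θ : Signal L} (hθ : ‖θ‖ ≤ 1) (δ : Signal L) :
    Integrable (fun y => incr G θ δ y) (law G 1 θ) :=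
  (integrable_ell G hθ _).sub (integrable_ell G hθ _)

/-- The Kullback-Leibler divergence is the expected decrease of the log-likelihood, which is
nonnegative. -/
lemma klDiv_law_one {θ : Signal L} (hθ : ‖θ‖ ≤ 1) (δ : Signal L) :
    InformationTheory.klDiv (law G 1 θ) (law G 1 (θ + δ)) =
      ENNReal.ofReal (-∫ y, incr G θ δ y ∂(law G 1 θ)) ∧
      0 ≤ -∫ y, incr G θ δ y ∂(law G 1 θ) := by
  have hm : ∀ φ, Measurable fun y => ENNReal.ofReal (Real.exp (ell G y φ)) := fun φ =>
    ENNReal.measurable_ofReal.comp (Real.measurable_exp.comp (measurable_ell G φ))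
  have hi : Measurable fun y => ENNReal.ofReal (Real.exp (-incr G θ δ y)) :=
    ENNReal.measurable_ofReal.comp (Real.measurable_exp.comp (measurable_incr G θ δ).neg)
  have hd : law G 1 θ = (law G 1 (θ + δ)).withDensity
      fun y => ENNReal.ofReal (Real.exp (-incr G θ δ y)) := by
    rw [law_one_eq G (θ + δ), ← withDensity_mul _ (hm _) hi, law_one_eq]
    congr 1
    ext y
    rw [Pi.mul_apply, ← ENNReal.ofReal_mul (Real.exp_pos _).le, ← Real.exp_add, incr]
    congr 2
    ring
  have hac : law G 1 θ ≪ law G 1 (θ + δ) := by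
    conv_lhs => rw [hd]
    exact withDensity_absolutelyContinuous _ _
  have hr := hac.ae_le (Measure.rnDeriv_withDensity (law G 1 (θ + δ)) hi)
  rw [← hd] at hr
  have hllr : llr (law G 1 θ) (law G 1 (θ + δ)) =ᵐ[law G 1 θ] fun y => -incr G θ δ y := by
    filter_upwards [hr] with y hy
    rw [llr, hy, ENNReal.toReal_ofReal (Real.exp_pos _).le, Real.log_exp]
  have hint : Integrable (llr (law G 1 θ) (law G 1 (θ + δ))) (law G 1 θ) :=
    (integrable_incr G hθ δ).neg.congr hllr.symm
  have hnn := InformationTheory.integral_llr_add_sub_measure_univ_nonneg hac hint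
  rw [InformationTheory.klDiv_of_ac_of_integrable hac hint]
  rw [integral_congr_ae hllr, integral_neg] at hnn ⊢
  simpa using hnn

lemma law_eq_map_smul (σ : ℝ) (hσ : 0 < σ) (θ : Signal L) :
    law G σ θ = (law G 1 (σ⁻¹ • θ)).map (fun y => σ • y) := by
  have h1 : Measurable fun p : G × Signal L => act (p.1 : O L) (σ⁻¹ • θ) + (1 : ℝ) • p.2 :=
    ((continuous_act_left G _).measurable.comp measurable_fst).add
      (measurable_snd.const_smul (1 : ℝ))
  have h2 : Measurable fun y : Signal L => σ • y := measurable_const_smul σ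
  rw [law, law, Measure.map_map h2 h1]
  congr 1
  ext1 p
  simp only [Function.comp_apply]
  rw [smul_add, act_smul, smul_smul, mul_inv_cancel₀ hσ.ne', one_smul, one_smul]

/-- Data processing under multiplication by `σ`; this direction alone transfers a lower bound at
noise `σ` to unit noise. -/
lemma klDiv_law_le (σ : ℝ) (hσ : 0 < σ) (θ φ : Signal L) :
    InformationTheory.klDiv (law G σ θ) (law G σ φ) ≤
      InformationTheory.klDiv (law G 1 (σ⁻¹ • θ)) (law G 1 (σ⁻¹ • φ)) := by
  rw [law_eq_map_smul G σ hσ θ, law_eq_map_smul G σ hσ φ]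
  exact InformationTheory.klDiv_map_le _ _ (measurable_const_smul σ)

/-- The two log-likelihoods differ by a term free of `φ`, so their maximizers correspond. -/
lemma logLik_smul {σ : ℝ} (hσ : 0 < σ) {n : ℕ} (y : Fin n → Signal L) (φ : Signal L) :
    logLik G σ (fun i => σ • y i) φ = ∑ i, ell G (y i) (σ⁻¹ • φ) - ∑ i, ‖y i‖ ^ 2 / 2 := by
  rw [logLik, ← Finset.sum_sub_distrib]
  refine Finset.sum_congr rfl fun i _ => ?_
  have h1 : ∀ g : G, Real.exp (-(1 / (2 * σ ^ 2)) * ‖σ • y i - act (g : O L) φ‖ ^ 2) =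
      Real.exp (-(‖y i‖ ^ 2 / 2)) * Real.exp (⟪y i, act (g : O L) (σ⁻¹ • φ)⟫ -
        ‖σ⁻¹ • φ‖ ^ 2 / 2) := fun g => by
    rw [← Real.exp_add]
    congr 1
    rw [norm_sub_sq_real, act_smul, norm_act, norm_smul, norm_smul, inner_smul_right,
      real_inner_smul_left, norm_inv, Real.norm_of_nonneg hσ.le]
    field_simp
    ring
  simp_rw [h1]
  rw [integral_const_mul, ← exp_ell, ← Real.exp_add, Real.log_exp]
  ring

/-- A point whose likelihood is at least that of `0` has norm at most twice the mean norm of the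
observations. -/
lemma norm_le_of_sum_ell_nonneg {n : ℕ} (hn : 1 ≤ n) (y : Fin n → Signal L) (φ : Signal L)
    (h : 0 ≤ ∑ i, ell G (y i) φ) : ‖φ‖ ≤ 2 * ((∑ i, ‖y i‖) / n) := by
  have hn' : (0 : ℝ) < n := by exact_mod_cast hn
  have h1 : ∑ i, ell G (y i) φ ≤ (∑ i, ‖y i‖) * ‖φ‖ - n * (‖φ‖ ^ 2 / 2) := by
    rw [Finset.sum_mul]
    have : (n : ℝ) * (‖φ‖ ^ 2 / 2) = ∑ _i : Fin n, ‖φ‖ ^ 2 / 2 := by simp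
    rw [this, ← Finset.sum_sub_distrib]
    refine Finset.sum_le_sum fun i _ => ?_
    have h1 := (le_abs_self _).trans (abs_log_lik_le G (y i) φ)
    rw [ell]
    linarith
  rcases (norm_nonneg φ).eq_or_lt with h0 | h0
  · rw [← h0]
    exact mul_nonneg zero_le_two (div_nonneg (Finset.sum_nonneg fun i _ => norm_nonneg _) hn'.le)
  · have h2 : (n : ℝ) * ‖φ‖ / 2 ≤ ∑ i, ‖y i‖ := by
      by_contra hc
      push Not at hc
      have h3 := mul_lt_mul_of_pos_right hc h0
      have h4 : (n : ℝ) * ‖φ‖ / 2 * ‖φ‖ = n * (‖φ‖ ^ 2 / 2) := by ring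
      linarith
    rw [← mul_div_assoc, le_div_iff₀ hn']
    linarith

end Scaling

/-! ### Moments of score and posterior covariance; Fisher information. -/

section Moments

variable {L : ℕ} (G : Subgroup (O L)) [CompactSpace G]

lemma integral_inner_stdGaussian (a : Signal L) :
    ∫ x : Signal L, (⟪x, a⟫ : ℝ) ∂(stdGaussian (Signal L)) = 0 := by
  have := integral_strongDual_stdGaussian (E := Signal L) (innerSL ℝ a)
  simpa only [innerSL_apply_apply, real_inner_comm] using this

lemma integral_inner_sq_stdGaussian (a : Signal L) :
    ∫ x : Signal L, (⟪x, a⟫ : ℝ) ^ 2 ∂(stdGaussian (Signal L)) = ‖a‖ ^ 2 := by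
  have h := variance_dual_stdGaussian (E := Signal L) (innerSL ℝ a)
  rw [variance_of_integral_eq_zero (by fun_prop) (integral_strongDual_stdGaussian _),
    innerSL_apply_norm] at h
  simpa only [innerSL_apply_apply, real_inner_comm] using h

variable (L) in
/-- Moments of the standard Gaussian norm, dominating those of all observations. -/
def gaussMoment (m : ℕ) : ℝ := ∫ x : Signal L, (2 + ‖x‖) ^ m ∂(stdGaussian (Signal L))

lemma one_le_gaussMoment (m : ℕ) : 1 ≤ gaussMoment L m := by
  have h : ∫ _x : Signal L, (1 : ℝ) ∂(stdGaussian (Signal L)) ≤ gaussMoment L m :=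
    integral_mono (integrable_const _) (integrable_norm_stdGaussian_pow m 2) fun x =>
      one_le_pow₀ (by linarith [norm_nonneg x])
  simpa using h

variable {θ : Signal L} (hθ : ‖θ‖ ≤ 1)

include hθ in
lemma integrable_pow_law (m : ℕ) : Integrable (fun y => (1 + ‖y‖) ^ m) (law G 1 θ) ∧
    ∫ y, (1 + ‖y‖) ^ m ∂(law G 1 θ) ≤ gaussMoment L m := by
  have heq : ∀ x : Signal L, (1 + (1 + ‖x‖)) ^ m = (2 + ‖x‖) ^ m := fun x => by
    rw [← add_assoc]; norm_num
  have := integrable_law_of_monotone G hθ (h := fun x => (1 + x) ^ m) (by fun_prop)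
    (fun x hx y _ hxy => by
      have : (0 : ℝ) ≤ x := hx
      simp only
      gcongr)
    (fun x hx => by positivity)
    (by simp only [heq]; exact integrable_norm_stdGaussian_pow m 2)
  rw [gaussMoment]
  simpa only [heq] using this

include hθ in
/-- Functions of polynomial growth are integrable. -/
lemma integrable_law_of_le {f : Signal L → ℝ} (hf : Measurable f) {a : ℝ} (m : ℕ)
    (h : ∀ y, |f y| ≤ a * (1 + ‖y‖) ^ m) : Integrable f (law G 1 θ) :=
  ((integrable_pow_law G hθ m).1.const_mul a).mono' hf.aestronglyMeasurable (ae_of_all _ h)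

/-- At `y = g θ + x` the signal cancels against the centring and only noise is left: conditionally
on `g`, mean zero and variance `‖δ‖²`. This drives `integral_score` and `integral_postCov`. -/
lemma lin_shift (θ δ x : Signal L) (g : G) :
    lin G θ (g, act (g : O L) θ + x) δ = ⟪x, act (g : O L) δ⟫ := by
  rw [lin_apply, inner_add_left, inner_act]
  ring

lemma integrable_inner_act_pow (δ : Signal L) (m : ℕ) :
    Integrable (fun p : G × Signal L => (⟪p.2, act (p.1 : O L) δ⟫ : ℝ) ^ m)
      ((unif G).prod (stdGaussian (Signal L))) := by
  have h := ((integrable_norm_stdGaussian_pow (L := L) m 0).mul_const (‖δ‖ ^ m)).comp_snd (unif G)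
  refine h.mono' ((continuous_inner_act G δ).pow m).aestronglyMeasurable (ae_of_all _ fun p => ?_)
  rw [norm_pow, Real.norm_eq_abs, zero_add, ← mul_pow]
  exact pow_le_pow_left₀ (abs_nonneg _) (abs_inner_act_le _ _ _) m

lemma integral_score (δ : Signal L) : ∫ y, score G hθ y δ ∂(law G 1 θ) = 0 := by
  have hm : Measurable fun p : G × Signal L => lin G θ p δ := (continuous_lin G θ δ).measurable
  have hi := integrable_inner_act_pow G δ 1
  simp only [pow_one] at hi
  have hj : Integrable (fun p : G × Signal L => lin G θ p δ) (joint G θ) := by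
    rw [integrable_joint_iff G θ hm]
    simpa only [lin_shift] using hi
  have h := integral_integral_post G θ hj
  rw [integral_joint G θ hm] at h
  simp only [lin_shift] at h
  rw [integral_prod _ hi] at h
  simp only [integral_inner_stdGaussian, integral_zero] at h
  exact h

lemma integrable_score_mul (δ δ' : Signal L) :
    Integrable (fun y => score G hθ y δ * score G hθ y δ') (law G 1 θ) :=
  integrable_law_of_le G hθ ((measurable_score G hθ δ).mul (measurable_score G hθ δ'))
    (a := ‖δ‖ * ‖δ'‖) 2 fun y => by
      rw [abs_mul]
      refine (mul_le_mul (abs_score_le G hθ y δ) (abs_score_le G hθ y δ') (abs_nonneg _)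
        (by positivity)).trans_eq ?_
      ring

lemma integrable_postCov (δ δ' : Signal L) :
    Integrable (fun y => postCov G hθ y δ δ') (law G 1 θ) :=
  integrable_law_of_le G hθ (measurable_postCov G hθ δ δ')
    (a := 2 * (‖δ‖ * ‖δ'‖)) 2 fun y => (abs_postCov_le G hθ y δ δ').trans_eq (by ring)

/-- The information identity. -/
lemma integral_postCov (δ : Signal L) : ∫ y, postCov G hθ y δ δ ∂(law G 1 θ) =
    ‖δ‖ ^ 2 - ∫ y, score G hθ y δ * score G hθ y δ ∂(law G 1 θ) := by
  have hm : Measurable fun p : G × Signal L => lin G θ p δ * lin G θ p δ :=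
    ((continuous_lin G θ δ).mul (continuous_lin G θ δ)).measurable
  have hi := integrable_inner_act_pow G δ 2
  have hj : Integrable (fun p : G × Signal L => lin G θ p δ * lin G θ p δ) (joint G θ) := by
    rw [integrable_joint_iff G θ hm]
    simpa only [lin_shift, ← sq] using hi
  have h := integral_integral_post G θ hj
  rw [integral_joint G θ hm] at h
  simp only [lin_shift, ← sq] at h
  rw [integral_prod _ hi] at h
  simp only [integral_inner_sq_stdGaussian, norm_act, integral_const, probReal_univ, one_smul] at h
  have h2 := integral_add (integrable_postCov G hθ δ δ) (integrable_score_mul G hθ δ δ)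
  simp only [postCov, sub_add_cancel] at h2
  simp only [← sq] at h2 ⊢
  simp only [postCov, ← sq]
  linarith

/-- Integrating the pointwise expansion, the score has mean zero and the information identity
cancels `‖δ‖² / 2`: the divergence is half the Fisher form up to a cubic error. -/
lemma abs_integral_incr_add_le (δ : Signal L) :
    |∫ y, incr G θ δ y ∂(law G 1 θ) +
      (∫ y, score G hθ y δ * score G hθ y δ ∂(law G 1 θ)) / 2| ≤
      40 * (gaussMoment L 3 * ‖δ‖ ^ 3) := by
  obtain ⟨h3, h3'⟩ := integrable_pow_law G hθ 3
  have hs : Integrable (fun y => score G hθ y δ) (law G 1 θ) :=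
    integrable_law_of_le G hθ (measurable_score G hθ δ) (a := ‖δ‖) 1
      fun y => (abs_score_le G hθ y δ).trans_eq (by ring)
  have hc := (integrable_postCov G hθ δ δ).div_const 2
  have hsc : Integrable (fun y => score G hθ y δ + postCov G hθ y δ δ / 2) (law G 1 θ) := hs.add hc
  have hscd : Integrable (fun y => score G hθ y δ + postCov G hθ y δ δ / 2 - ‖δ‖ ^ 2 / 2)
    (law G 1 θ) := hsc.sub (integrable_const _)
  have h1 : ∫ y, (incr G θ δ y - (score G hθ y δ + postCov G hθ y δ δ / 2 - ‖δ‖ ^ 2 / 2))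
      ∂(law G 1 θ) = ∫ y, incr G θ δ y ∂(law G 1 θ) +
      (∫ y, score G hθ y δ * score G hθ y δ ∂(law G 1 θ)) / 2 := by
    rw [integral_sub (integrable_incr G hθ δ) hscd, integral_sub hsc (integrable_const _),
      integral_add hs hc, integral_div, integral_postCov, integral_score]
    simp
    ring
  rw [← h1]
  refine abs_integral_le_integral_abs.trans ?_
  have h4 : ∫ y, 40 * ((1 + ‖y‖) ^ 3 * ‖δ‖ ^ 3) ∂(law G 1 θ) ≤ 40 * (gaussMoment L 3 * ‖δ‖ ^ 3) := by
    rw [integral_const_mul, integral_mul_const]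
    gcongr
  exact (integral_mono (((integrable_incr G hθ δ).sub hscd).norm)
    ((h3.mul_const _).const_mul _) fun y => abs_incr_sub_expansion_le G hθ δ y).trans h4

lemma score_mul_score_eq_sum (y u v : Signal L) : score G hθ y u * score G hθ y v =
    ∑ j, ∑ k, u j * v k * (score G hθ y (EuclideanSpace.single j 1) *
      score G hθ y (EuclideanSpace.single k 1)) := by
  have h : ∀ w, score G hθ y w = ∑ j, w j * score G hθ y (EuclideanSpace.single j 1) := fun w => by
    conv_lhs => rw [eq_sum_single w]
    simp
  rw [h u, h v, Finset.sum_mul_sum]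
  exact Finset.sum_congr rfl fun j _ => Finset.sum_congr rfl fun k _ => by ring

/-- An orthonormal basis in whose directions the scores are uncorrelated. -/
lemma exists_basis_score_uncorrelated : ∃ e : OrthonormalBasis (Fin L) ℝ (Signal L),
    ∀ i j, i ≠ j → ∫ y, score G hθ y (e i) * score G hθ y (e j) ∂(law G 1 θ) = 0 := by
  -- The Fisher information matrix in standard coordinates; its eigenvectors are the required basis.
  let A : Matrix (Fin L) (Fin L) ℝ := fun j k => ∫ y, score G hθ y (EuclideanSpace.single j 1) *
      score G hθ y (EuclideanSpace.single k 1) ∂(law G 1 θ)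
  have hA : A.IsHermitian := by
    ext j k
    rw [Matrix.conjTranspose_apply, star_trivial]
    exact integral_congr_ae (ae_of_all _ fun y => mul_comm _ _)
  have hB : ∀ u v : Signal L, ∫ y, score G hθ y u * score G hθ y v ∂(law G 1 θ) =
      ∑ j, u j * (A.mulVec v.ofLp) j := fun u v => by
    simp_rw [score_mul_score_eq_sum G hθ _ u v]
    rw [integral_finsetSum _ fun j _ => integrable_finsetSum _ fun k _ =>
      (integrable_score_mul G hθ _ _).const_mul _]
    refine Finset.sum_congr rfl fun j _ => ?_
    rw [integral_finsetSum _ fun k _ => (integrable_score_mul G hθ _ _).const_mul _,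
      Matrix.mulVec, dotProduct, Finset.mul_sum]
    refine Finset.sum_congr rfl fun k _ => ?_
    rw [integral_const_mul]
    simp only [A]
    ring
  refine ⟨hA.eigenvectorBasis, fun i j hij => ?_⟩
  rw [hB, hA.mulVec_eigenvectorBasis]
  have := hA.eigenvectorBasis.orthonormal.2 hij
  simp only [PiLp.inner_apply, RCLike.inner_apply, conj_trivial] at this
  simp only [Pi.smul_apply, smul_eq_mul]
  rw [← mul_zero (hA.eigenvalues j), ← this, Finset.mul_sum]
  exact Finset.sum_congr rfl fun k _ => by ring

lemma integral_score_sq_eq_sum {e : OrthonormalBasis (Fin L) ℝ (Signal L)}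
    (he : ∀ i j, i ≠ j → ∫ y, score G hθ y (e i) * score G hθ y (e j) ∂(law G 1 θ) = 0)
    (δ : Signal L) : ∫ y, score G hθ y δ * score G hθ y δ ∂(law G 1 θ) =
      ∑ j, ⟪e j, δ⟫ ^ 2 * ∫ y, score G hθ y (e j) * score G hθ y (e j) ∂(law G 1 θ) := by
  have h : ∀ y, score G hθ y δ * score G hθ y δ = ∑ j, ∑ k, ⟪e j, δ⟫ * ⟪e k, δ⟫ *
      (score G hθ y (e j) * score G hθ y (e k)) := fun y => by
    have h1 : score G hθ y δ = ∑ j, ⟪e j, δ⟫ * score G hθ y (e j) := by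
      conv_lhs => rw [← e.sum_repr' δ]
      simp
    rw [h1, Finset.sum_mul_sum]
    exact Finset.sum_congr rfl fun j _ => Finset.sum_congr rfl fun k _ => by ring
  simp_rw [h]
  rw [integral_finsetSum _ fun j _ => integrable_finsetSum _ fun k _ =>
    (integrable_score_mul G hθ _ _).const_mul _]
  refine Finset.sum_congr rfl fun j _ => ?_
  rw [integral_finsetSum _ fun k _ => (integrable_score_mul G hθ _ _).const_mul _,
    Finset.sum_eq_single j]
  · rw [integral_const_mul, sq]
  · intro k _ hk
    rw [integral_const_mul, he j k hk.symm, mul_zero]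
  · simp

end Moments

/-! ### Empirical means: variance and Chernoff bounds. -/

section Averages

variable {Ω : Type*} {n : ℕ}

/-- The empirical mean of `f` over the sample `y`. -/
def avg (f : Ω → ℝ) (y : Fin n → Ω) : ℝ := (∑ i, f (y i)) / n

lemma avg_mono (f g : Ω → ℝ) (h : ∀ x, f x ≤ g x) (y : Fin n → Ω) : avg f y ≤ avg g y :=
  div_le_div_of_nonneg_right (Finset.sum_le_sum fun i _ => h (y i)) (Nat.cast_nonneg n)

lemma avg_const (hn : 1 ≤ n) (a : ℝ) (y : Fin n → Ω) : avg (fun _ => a) y = a := by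
  have : (n : ℝ) ≠ 0 := by positivity
  simp [avg]
  field_simp

lemma avg_add (f g : Ω → ℝ) (y : Fin n → Ω) :
    avg (fun x => f x + g x) y = avg f y + avg g y := by
  simp [avg, Finset.sum_add_distrib, add_div]

lemma avg_const_mul (a : ℝ) (f : Ω → ℝ) (y : Fin n → Ω) :
    avg (fun x => a * f x) y = a * avg f y := by
  simp [avg, ← Finset.mul_sum, mul_div_assoc]

variable [MeasurableSpace Ω] (P : Measure Ω) [IsProbabilityMeasure P]

lemma measurable_avg {f : Ω → ℝ} (hf : Measurable f) :
    Measurable fun y : Fin n → Ω => avg f y :=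
  (Finset.measurable_sum _ fun i _ => hf.comp (measurable_pi_apply i)).div_const _

lemma integrable_avg {f : Ω → ℝ} (hf : Integrable f P) :
    Integrable (fun y : Fin n → Ω => avg f y) (Measure.pi fun _ => P) :=
  (integrable_finsetSum _ fun i _ => integrable_comp_eval hf).div_const _

lemma integral_avg (hn : 1 ≤ n) {f : Ω → ℝ} (hf : Integrable f P) :
    ∫ y : Fin n → Ω, avg f y ∂(Measure.pi fun _ => P) = ∫ x, f x ∂P := by
  have hn' : (n : ℝ) ≠ 0 := by positivity
  unfold avg
  rw [integral_div, integral_finsetSum _ fun i _ => integrable_comp_eval hf]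
  simp_rw [integral_comp_eval (μ := fun _ : Fin n => P) hf.aestronglyMeasurable]
  simp [hn']

/-- The mean squared deviation of an empirical mean is at most the second moment over `n`. -/
lemma integral_avg_sub_sq_le (hn : 1 ≤ n) {f : Ω → ℝ} (hf : MemLp f 2 P) :
    Integrable (fun y : Fin n → Ω => (avg f y - ∫ x, f x ∂P) ^ 2) (Measure.pi fun _ => P) ∧
    ∫ y : Fin n → Ω, (avg f y - ∫ x, f x ∂P) ^ 2 ∂(Measure.pi fun _ => P) ≤
      (∫ x, f x ^ 2 ∂P) / n := by
  have hn' : (n : ℝ) ≠ 0 := by positivity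
  have hi : Integrable f P := hf.integrable (by norm_num)
  have hm : MemLp (fun y : Fin n → Ω => avg f y) 2 (Measure.pi fun _ => P) := by
    have h1 : MemLp (fun y : Fin n → Ω => ∑ i, f (y i)) 2 (Measure.pi fun _ => P) :=
      memLp_finsetSum _ fun i _ =>
        hf.comp_measurePreserving (measurePreserving_eval (fun _ : Fin n => P) i)
    have := h1.mul_const (n : ℝ)⁻¹
    simpa only [avg, div_eq_mul_inv] using this
  refine ⟨(hm.sub (memLp_const _)).integrable_sq, ?_⟩
  have hv := variance_eq_integral (μ := Measure.pi fun _ : Fin n => P) hm.aemeasurable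
  rw [integral_avg P hn hi] at hv
  rw [← hv]
  have h1 : Var[fun y : Fin n → Ω => avg f y; Measure.pi fun _ => P] = Var[f; P] / n := by
    have h2 : (fun y : Fin n → Ω => avg f y) =
        fun y => (n : ℝ)⁻¹ * (∑ i, fun y : Fin n → Ω => f (y i)) y := by
      ext y
      simp [avg, div_eq_inv_mul]
    rw [h2, variance_const_mul, variance_sum_pi fun _ => hf]
    simp
    field_simp
  rw [h1]
  gcongr
  exact variance_le_expectation_sq hf.aestronglyMeasurable

/-- Chernoff bound for empirical means of sub-Gaussian variables. -/
lemma measure_avg_ge_le (hn : 1 ≤ n) {f : Ω → ℝ} (hf : Measurable f) {c : NNReal}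
    (h : HasSubgaussianMGF f c P) {u : ℝ} (hu : 0 ≤ u) :
    (Measure.pi fun _ : Fin n => P).real {y | u ≤ avg f y} ≤ Real.exp (-(n * u ^ 2) / (2 * c)) := by
  have hn' : (0 : ℝ) < n := by positivity
  have hind : iIndepFun (fun (i : Fin n) (y : Fin n → Ω) => f (y i)) (Measure.pi fun _ => P) :=
    iIndepFun_pi fun _ => hf.aemeasurable
  have hsub : ∀ i ∈ (Finset.univ : Finset (Fin n)),
      HasSubgaussianMGF (fun y : Fin n → Ω => f (y i)) c (Measure.pi fun _ => P) := fun i _ => by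
    have hmp := measurePreserving_eval (fun _ : Fin n => P) i
    refine HasSubgaussianMGF.of_map hmp.measurable.aemeasurable ?_
    rw [hmp.map_eq]
    exact h
  have := HasSubgaussianMGF.measure_sum_ge_le_of_iIndepFun hind (c := fun _ => c) hsub
    (ε := n * u) (by positivity)
  simp only [Finset.sum_const, Finset.card_univ, Fintype.card_fin] at this
  have hset : {y : Fin n → Ω | u ≤ avg f y} = {y | n * u ≤ ∑ i, f (y i)} := by
    ext y
    simp only [Set.mem_ofPred_eq, avg, le_div_iff₀ hn', mul_comm u]
  rw [hset]
  refine this.trans_eq ?_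
  congr 1
  push_cast [nsmul_eq_mul]
  rcases eq_or_ne (c : ℝ) 0 with h0 | h0
  · simp [h0]
  · field_simp

end Averages

/-! ### Sub-Gaussian increments, uniformly over groups and parameters. -/

section SubGaussian

variable {L : ℕ}

lemma exp_le_one_add_add_sq_mul_exp (x : ℝ) : Real.exp x ≤ 1 + x + x ^ 2 * Real.exp |x| := by
  have h := Complex.norm_exp_sub_sum_le_norm_mul_exp (x : ℂ) 2
  simp only [Finset.sum_range_succ, Finset.sum_range_zero, pow_zero, pow_one, Nat.factorial_zero,
    Nat.factorial_one, Nat.cast_one, div_one, zero_add, Complex.norm_real, Real.norm_eq_abs,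
    sq_abs] at h
  have h2 : (Complex.exp x - (1 + x)) = ((Real.exp x - (1 + x) : ℝ) : ℂ) := by push_cast; ring
  rw [h2, Complex.norm_real, Real.norm_eq_abs] at h
  linarith [le_abs_self (Real.exp x - (1 + x))]

/-- Exponential moments of the observation grow at most like those of a Gaussian, uniformly over
the model. -/
lemma exists_integral_exp_law_le (L : ℕ) (b : ℝ) : ∃ A B : ℝ, 0 < A ∧ 0 < B ∧
    ∀ (G : Subgroup (O L)) [CompactSpace G] (θ : Signal L), ‖θ‖ ≤ 1 → ∀ s : ℝ, 0 ≤ s →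
      Integrable (fun y => Real.exp (s * (‖y‖ + b))) (law G 1 θ) ∧
      ∫ y, Real.exp (s * (‖y‖ + b)) ∂(law G 1 θ) ≤ A * Real.exp (B * s ^ 2) := by
  obtain ⟨κ, hκ, hi⟩ := IsGaussian.exists_integrable_exp_sq (stdGaussian (Signal L))
  set Q := ∫ x : Signal L, Real.exp (κ * ‖x‖ ^ 2) ∂(stdGaussian (Signal L)) with hQ
  have hQ0 : 0 < Q := integral_exp_pos hi
  refine ⟨Real.exp (κ * (1 + b) ^ 2) * Q, 1 / (2 * κ), by positivity, by positivity,
    -- Fernique's theorem supplies `κ`. Young's inequality bounds `s (1 + b + ‖x‖)` by `s² / (2κ) +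
    -- κ (1 + b + ‖x‖)² / 2`, and the last square is at most `2 (1 + b)² + 2 ‖x‖²`.
    fun G _ θ hθ s hs => ?_⟩
  have hpt : ∀ x : Signal L, Real.exp (s * (1 + ‖x‖ + b)) ≤
      Real.exp (κ * (1 + b) ^ 2) * Real.exp (1 / (2 * κ) * s ^ 2) * Real.exp (κ * ‖x‖ ^ 2) :=
    fun x => by
      rw [← Real.exp_add, ← Real.exp_add]
      refine Real.exp_le_exp.2 ?_
      have h1 : 1 / (2 * κ) * s ^ 2 + κ * (1 + b + ‖x‖) ^ 2 / 2 - s * (1 + ‖x‖ + b) =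
          (s - κ * (1 + b + ‖x‖)) ^ 2 / (2 * κ) := by
        field_simp
        ring
      have h2 : 0 ≤ (s - κ * (1 + b + ‖x‖)) ^ 2 / (2 * κ) := by positivity
      nlinarith [mul_nonneg hκ.le (sq_nonneg (1 + b - ‖x‖))]
  have hdom : Integrable (fun x : Signal L => Real.exp (κ * (1 + b) ^ 2) *
      Real.exp (1 / (2 * κ) * s ^ 2) * Real.exp (κ * ‖x‖ ^ 2)) (stdGaussian (Signal L)) :=
    hi.const_mul _
  have hint : Integrable (fun x : Signal L => Real.exp (s * (1 + ‖x‖ + b)))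
      (stdGaussian (Signal L)) :=
    hdom.mono' (by fun_prop) (ae_of_all _ fun x => by
      rw [Real.norm_of_nonneg (Real.exp_pos _).le]
      exact hpt x)
  obtain ⟨h1, h2⟩ := integrable_law_of_monotone G hθ (h := fun r => Real.exp (s * (r + b)))
    (by fun_prop) (fun x _ y _ hxy => Real.exp_le_exp.2 (by gcongr))
    (fun x _ => (Real.exp_pos _).le) hint
  refine ⟨h1, h2.trans ((integral_mono hint hdom hpt).trans_eq ?_)⟩
  rw [integral_const_mul]
  ring

/-- Increments of the log-likelihood are sub-Gaussian, with variance proxy of order `‖δ‖²`. -/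
lemma exists_hasSubgaussianMGF_incr (L : ℕ) {M : ℝ} (hM : 0 ≤ M) : ∃ K : NNReal, 0 < K ∧
    ∀ (G : Subgroup (O L)) [CompactSpace G] (θ : Signal L), ‖θ‖ ≤ 1 → ∀ δ : Signal L, ‖δ‖ ≤ M →
      HasSubgaussianMGF (fun y => incr G θ δ y - ∫ y, incr G θ δ y ∂(law G 1 θ))
        (K * ‖δ‖₊ ^ 2) (law G 1 θ) := by
  have hm0 := one_le_gaussMoment (L := L) 1
  obtain ⟨b, hb⟩ : ∃ b, b = 1 + 2 * M + gaussMoment L 1 := ⟨_, rfl⟩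
  have hb0 : 0 ≤ b := by rw [hb]; linarith
  obtain ⟨A, B, hA, hB, hAB⟩ := exists_integral_exp_law_le L b
  refine ⟨(2 * (2 * A * Real.exp (2 * B) + 2 * B)).toNNReal,
    Real.toNNReal_pos.2 (by positivity), fun G _ θ hθ δ hδ => ?_⟩
  set m := ∫ y, incr G θ δ y ∂(law G 1 θ) with hm
  have hi := integrable_incr G hθ δ
  obtain ⟨hp, hp'⟩ := integrable_pow_law G hθ 1
  simp only [pow_one] at hp hp'
  have hmb : |m| ≤ (gaussMoment L 1 + M) * ‖δ‖ := by
    refine abs_integral_le_integral_abs.trans ?_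
    have hd : Integrable (fun y => (1 + ‖y‖ + M) * ‖δ‖) (law G 1 θ) :=
      (hp.add (integrable_const M)).mul_const _
    refine (integral_mono hi.abs hd fun y => (abs_incr_le G hθ δ y).trans (by gcongr)).trans ?_
    rw [integral_mul_const, integral_add hp (integrable_const M)]
    simp only [integral_const, probReal_univ, one_smul]
    gcongr
  have hζ : ∀ y, |incr G θ δ y - m| ≤ ‖δ‖ * (‖y‖ + b) := fun y => by
    refine (abs_sub _ _).trans ?_
    have h1 := (abs_incr_le G hθ δ y).trans
      (mul_le_mul_of_nonneg_right (add_le_add_right hδ (1 + ‖y‖)) (norm_nonneg δ))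
    calc _ ≤ (1 + ‖y‖ + M) * ‖δ‖ + (gaussMoment L 1 + M) * ‖δ‖ := add_le_add h1 hmb
      _ = _ := by rw [hb]; ring
  have hζm : Measurable fun y => incr G θ δ y - m := (measurable_incr G θ δ).sub_const m
  have hexp : ∀ t : ℝ, Integrable (fun y => Real.exp (t * (incr G θ δ y - m))) (law G 1 θ) :=
    fun t => by
      refine (hAB G θ hθ (|t| * ‖δ‖) (by positivity)).1.mono'
        (Real.measurable_exp.comp (hζm.const_mul t)).aestronglyMeasurable (ae_of_all _ fun y => ?_)
      rw [Real.norm_of_nonneg (Real.exp_pos _).le]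
      refine Real.exp_le_exp.2 ((le_abs_self _).trans ?_)
      rw [abs_mul, mul_assoc]
      exact mul_le_mul_of_nonneg_left (hζ y) (abs_nonneg t)
  refine ⟨hexp, fun t => ?_⟩
  obtain ⟨s, hs⟩ : ∃ s, s = |t| * ‖δ‖ := ⟨_, rfl⟩
  have hs0 : 0 ≤ s := by rw [hs]; positivity
  obtain ⟨h1, h2⟩ := hAB G θ hθ (s + 1) (by positivity)
  -- The linear term will integrate to zero. The factor `(‖y‖ + b)²` is at most `2 exp (‖y‖ + b)`,
  -- which raises the exponent from `s` to `s + 1`.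
  have hpt : ∀ y, Real.exp (t * (incr G θ δ y - m)) ≤
      1 + t * (incr G θ δ y - m) + 2 * s ^ 2 * Real.exp ((s + 1) * (‖y‖ + b)) := fun y => by
    have hx : |t * (incr G θ δ y - m)| ≤ s * (‖y‖ + b) := by
      rw [abs_mul, hs, mul_assoc]
      exact mul_le_mul_of_nonneg_left (hζ y) (abs_nonneg t)
    have hV : 0 ≤ ‖y‖ + b := by positivity
    refine (exp_le_one_add_add_sq_mul_exp _).trans ?_
    refine add_le_add le_rfl ?_
    have hq := Real.quadratic_le_exp_of_nonneg hV
    calc (t * (incr G θ δ y - m)) ^ 2 * Real.exp |t * (incr G θ δ y - m)|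
        ≤ (s * (‖y‖ + b)) ^ 2 * Real.exp (s * (‖y‖ + b)) := by
          rw [← sq_abs]
          gcongr
      _ ≤ (s ^ 2 * (2 * Real.exp (‖y‖ + b))) * Real.exp (s * (‖y‖ + b)) := by
          rw [mul_pow]
          gcongr
          nlinarith
      _ = _ := by
          rw [show (s + 1) * (‖y‖ + b) = (‖y‖ + b) + s * (‖y‖ + b) by ring,
            Real.exp_add (‖y‖ + b)]
          ring
  have hz : Integrable (fun y => incr G θ δ y - m) (law G 1 θ) := hi.sub (integrable_const m)
  have hz1 : Integrable (fun y => 1 + t * (incr G θ δ y - m)) (law G 1 θ) :=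
    (integrable_const 1).add (hz.const_mul t)
  have hz0 : ∫ y, (incr G θ δ y - m) ∂(law G 1 θ) = 0 := by
    rw [integral_sub hi (integrable_const m)]
    simp [hm]
  have hmgf : mgf (fun y => incr G θ δ y - m) (law G 1 θ) t ≤
      1 + 2 * s ^ 2 * (A * Real.exp (B * (s + 1) ^ 2)) := by
    have hz2 : Integrable (fun y => 1 + t * (incr G θ δ y - m) +
      2 * s ^ 2 * Real.exp ((s + 1) * (‖y‖ + b))) (law G 1 θ) := hz1.add (h1.const_mul _)
    refine (integral_mono (hexp t) hz2 hpt).trans ?_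
    rw [integral_add hz1 (h1.const_mul _), integral_add (integrable_const 1) (hz.const_mul t),
      integral_const_mul, hz0, integral_const_mul]
    simp only [integral_const, probReal_univ, one_smul, mul_zero, add_zero]
    gcongr
  refine hmgf.trans ?_
  have h3 : Real.exp (B * (s + 1) ^ 2) ≤ Real.exp (2 * B) * Real.exp (2 * B * s ^ 2) := by
    rw [← Real.exp_add]
    exact Real.exp_le_exp.2 (by nlinarith [mul_nonneg hB.le (sq_nonneg (s - 1))])
  have h4 : 1 ≤ Real.exp (2 * B * s ^ 2) := Real.one_le_exp (by positivity)
  have h5 := Real.add_one_le_exp (2 * A * Real.exp (2 * B) * s ^ 2)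
  calc 1 + 2 * s ^ 2 * (A * Real.exp (B * (s + 1) ^ 2))
      ≤ Real.exp (2 * B * s ^ 2) +
        2 * s ^ 2 * (A * (Real.exp (2 * B) * Real.exp (2 * B * s ^ 2))) := by gcongr
    _ = (2 * A * Real.exp (2 * B) * s ^ 2 + 1) * Real.exp (2 * B * s ^ 2) := by ring
    _ ≤ Real.exp (2 * A * Real.exp (2 * B) * s ^ 2) * Real.exp (2 * B * s ^ 2) := by gcongr
    _ = _ := by
      rw [← Real.exp_add]
      congr 1
      rw [NNReal.coe_mul, NNReal.coe_pow, coe_nnnorm, Real.coe_toNNReal _ (by positivity),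
        hs, mul_pow, sq_abs]
      ring

end SubGaussian

/-! ### A finite net of a ball. -/

section Grid

variable {L : ℕ}

/-- The grid of mesh `h` with `2 Q + 1` points in each coordinate direction. -/
def grid (L Q : ℕ) (h : ℝ) : Finset (Signal L) :=
  (Fintype.piFinset fun _ : Fin L => Finset.Icc (-(Q : ℤ)) Q).image
    fun z => WithLp.toLp 2 fun j => h * (z j : ℝ)

lemma card_grid_le (L Q : ℕ) (h : ℝ) : (grid L Q h).card ≤ (2 * Q + 1) ^ L := by
  refine Finset.card_image_le.trans ?_
  rw [Fintype.card_piFinset]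
  simp only [Int.card_Icc, Finset.prod_const, Finset.card_univ, Fintype.card_fin]
  refine Nat.pow_le_pow_left ?_ L
  omega

lemma norm_le_sum_abs (v : Signal L) : ‖v‖ ≤ ∑ j, |v j| := by
  conv_lhs => rw [eq_sum_single v]
  refine (norm_sum_le _ _).trans (Finset.sum_le_sum fun j _ => ?_)
  simp [norm_smul]

lemma abs_apply_le_norm (v : Signal L) (j : Fin L) : |v j| ≤ ‖v‖ := by
  simpa using PiLp.norm_apply_le v j

/-- Round each coordinate down to the mesh; the extra `1` in `hQ` covers a floor falling below `-(M
/ h)`. -/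
lemma exists_mem_grid {Q : ℕ} {h M : ℝ} (hh : 0 < h) (hQ : M / h + 1 ≤ Q) (δ : Signal L)
    (hδ : ‖δ‖ ≤ M) : ∃ δ' ∈ grid L Q h, ‖δ - δ'‖ ≤ L * h := by
  refine ⟨WithLp.toLp 2 fun j => h * ((⌊δ j / h⌋ : ℤ) : ℝ), ?_, ?_⟩
  · refine Finset.mem_image.2 ⟨fun j => ⌊δ j / h⌋, ?_, rfl⟩
    rw [Fintype.mem_piFinset]
    intro j
    have h1 := abs_le.1 ((abs_apply_le_norm δ j).trans hδ)
    have h2 : -(M / h) ≤ δ j / h := by rw [← neg_div]; gcongr; exact h1.1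
    have h3 : δ j / h ≤ M / h := by gcongr; exact h1.2
    rw [Finset.mem_Icc]
    constructor
    · rw [Int.le_floor]
      push_cast
      linarith
    · have := Int.floor_le (δ j / h)
      exact_mod_cast (by linarith : ((⌊δ j / h⌋ : ℤ) : ℝ) ≤ Q)
  · refine (norm_le_sum_abs _).trans ?_
    refine (Finset.sum_le_sum (g := fun _ => h) fun j _ => ?_).trans_eq (by simp)
    simp only [PiLp.sub_apply]
    have h1 := Int.floor_le (δ j / h)
    have h2 := Int.lt_floor_add_one (δ j / h)
    rw [le_div_iff₀ hh] at h1
    rw [div_lt_iff₀ hh] at h2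
    rw [abs_le]
    constructor <;> nlinarith

end Grid

/-! ### Deterministic error bounds in the local and far regimes. -/

section Pointwise

variable {L : ℕ} (G : Subgroup (O L)) [CompactSpace G] {θ : Signal L} (hθ : ‖θ‖ ≤ 1) {n : ℕ}

/-- Squared Frobenius deviation of the empirical posterior covariance from its mean. -/
def covDev (hθ : ‖θ‖ ≤ 1) (y : Fin n → Signal L) : ℝ :=
  ∑ p : Fin L × Fin L,
    (avg (fun x => postCov G hθ x (EuclideanSpace.single p.1 1) (EuclideanSpace.single p.2 1)) y -
      ∫ x, postCov G hθ x (EuclideanSpace.single p.1 1) (EuclideanSpace.single p.2 1)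
        ∂(law G 1 θ)) ^ 2

/-- The squared empirical score, normalized by the regularized Fisher information. -/
def scoreDev (hθ : ‖θ‖ ≤ 1) (lam : ℝ) (e : OrthonormalBasis (Fin L) ℝ (Signal L))
    (y : Fin n → Signal L) : ℝ :=
  ∑ j, avg (fun x => score G hθ x (e j)) y ^ 2 /
    (∫ x, score G hθ x (e j) * score G hθ x (e j) ∂(law G 1 θ) + lam)

lemma covDev_nonneg (y : Fin n → Signal L) : 0 ≤ covDev G hθ y :=
  Finset.sum_nonneg fun _ _ => sq_nonneg _

lemma integral_score_sq_nonneg (δ : Signal L) :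
    0 ≤ ∫ x, score G hθ x δ * score G hθ x δ ∂(law G 1 θ) :=
  integral_nonneg fun _ => mul_self_nonneg _

lemma scoreDev_nonneg {lam : ℝ} (hlam : 0 < lam) (e : OrthonormalBasis (Fin L) ℝ (Signal L))
    (y : Fin n → Signal L) : 0 ≤ scoreDev G hθ lam e y :=
  Finset.sum_nonneg fun j _ =>
    div_nonneg (sq_nonneg _) (by linarith [integral_score_sq_nonneg G hθ (e j)])

/-- Cauchy-Schwarz over matrix entries. The random factor does not involve `δ`, so the bound may be
used at a data-dependent `δ`. -/
lemma avg_postCov_sub_sq_le (y : Fin n → Signal L) (δ : Signal L) :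
    (avg (fun x => postCov G hθ x δ δ) y - ∫ x, postCov G hθ x δ δ ∂(law G 1 θ)) ^ 2 ≤
      (‖δ‖ ^ 2) ^ 2 * covDev G hθ y := by
  have h1 : avg (fun x => postCov G hθ x δ δ) y - ∫ x, postCov G hθ x δ δ ∂(law G 1 θ) =
      ∑ p : Fin L × Fin L, (δ p.1 * δ p.2) *
      (avg (fun x => postCov G hθ x (EuclideanSpace.single p.1 1) (EuclideanSpace.single p.2 1)) y -
      ∫ x, postCov G hθ x (EuclideanSpace.single p.1 1) (EuclideanSpace.single p.2 1)
        ∂(law G 1 θ)) := by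
    have hps : ∀ x, postCov G hθ x δ δ = ∑ p : Fin L × Fin L, δ p.1 * δ p.2 *
        postCov G hθ x (EuclideanSpace.single p.1 1) (EuclideanSpace.single p.2 1) := fun x => by
      rw [postCov_eq_sum, ← Fintype.sum_prod_type']
    simp_rw [mul_sub, Finset.sum_sub_distrib]
    congr 1
    · simp_rw [avg, hps, ← mul_div_assoc, Finset.mul_sum]
      rw [Finset.sum_comm, Finset.sum_div]
    · simp_rw [hps]
      rw [integral_finsetSum _ fun p _ => (integrable_postCov G hθ _ _).const_mul _]
      exact Finset.sum_congr rfl fun p _ => integral_const_mul _ _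
  have h2 : (‖δ‖ ^ 2) ^ 2 = ∑ p : Fin L × Fin L, (δ p.1 * δ p.2) ^ 2 := by
    rw [EuclideanSpace.real_norm_sq_eq, sq, Finset.sum_mul_sum, ← Fintype.sum_prod_type']
    exact Finset.sum_congr rfl fun p _ => by ring
  rw [h1, h2]
  exact Finset.sum_mul_sq_le_sq_mul_sq _ _ _

/-- In a basis diagonalizing the Fisher form, weighted Cauchy-Schwarz with weights "eigenvalue plus
`lam`" again separates a random factor from `δ`. The term `lam` keeps the weights positive when the
form is degenerate. -/
lemma avg_score_sq_le {lam : ℝ} (hlam : 0 < lam) {e : OrthonormalBasis (Fin L) ℝ (Signal L)}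
    (he : ∀ i j, i ≠ j → ∫ y, score G hθ y (e i) * score G hθ y (e j) ∂(law G 1 θ) = 0)
    (y : Fin n → Signal L) (δ : Signal L) :
    avg (fun x => score G hθ x δ) y ^ 2 ≤ scoreDev G hθ lam e y *
      (∫ x, score G hθ x δ * score G hθ x δ ∂(law G 1 θ) + lam * ‖δ‖ ^ 2) := by
  have h1 : avg (fun x => score G hθ x δ) y = ∑ j, ⟪e j, δ⟫ * avg (fun x => score G hθ x (e j)) y := by
    have h : ∀ x, score G hθ x δ = ∑ j, ⟪e j, δ⟫ * score G hθ x (e j) := fun x => by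
      conv_lhs => rw [← e.sum_repr' δ]
      simp
    simp_rw [avg, h, ← mul_div_assoc, Finset.mul_sum]
    rw [Finset.sum_comm, Finset.sum_div]
  have h2 : ∫ x, score G hθ x δ * score G hθ x δ ∂(law G 1 θ) + lam * ‖δ‖ ^ 2 =
      ∑ j, ⟪e j, δ⟫ ^ 2 *
        (∫ x, score G hθ x (e j) * score G hθ x (e j) ∂(law G 1 θ) + lam) := by
    rw [integral_score_sq_eq_sum G hθ he δ, ← e.sum_sq_inner_right δ, Finset.mul_sum,
      ← Finset.sum_add_distrib]
    exact Finset.sum_congr rfl fun j _ => by ring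
  rw [h1, h2, scoreDev]
  refine Finset.sum_sq_le_sum_mul_sum_of_sq_le_mul _
    (fun j _ => div_nonneg (sq_nonneg _) (by linarith [integral_score_sq_nonneg G hθ (e j)]))
    (fun j _ => mul_nonneg (sq_nonneg _) (by linarith [integral_score_sq_nonneg G hθ (e j)]))
    fun j _ => ?_
  have : ∫ x, score G hθ x (e j) * score G hθ x (e j) ∂(law G 1 θ) + lam ≠ 0 := by
    linarith [integral_score_sq_nonneg G hθ (e j)]
  exact le_of_eq (by field_simp)

lemma avg_incr_le (hn : 1 ≤ n) (y : Fin n → Signal L) (δ : Signal L) :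
    avg (fun x => incr G θ δ x) y ≤ avg (fun x => score G hθ x δ) y +
      (avg (fun x => postCov G hθ x δ δ) y - ‖δ‖ ^ 2) / 2 +
      40 * ‖δ‖ ^ 3 * avg (fun x => (1 + ‖x‖) ^ 3) y := by
  have h : ∀ x, incr G θ δ x ≤ score G hθ x δ + ((1 / 2) * postCov G hθ x δ δ +
      (-(‖δ‖ ^ 2 / 2) + (40 * ‖δ‖ ^ 3) * (1 + ‖x‖) ^ 3)) := fun x => by
    have := (abs_le.1 (abs_incr_sub_expansion_le G hθ δ x)).2
    linarith
  refine (avg_mono _ _ h y).trans_eq ?_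
  rw [avg_add, avg_add, avg_add, avg_const_mul, avg_const_mul, avg_const hn]
  ring

/-- Close to the truth, the estimation error is controlled by the normalized score. -/
lemma sq_norm_le_scoreDev (hn : 1 ≤ n) {lam : ℝ} (hlam : 0 < lam)
    {e : OrthonormalBasis (Fin L) ℝ (Signal L)}
    (he : ∀ i j, i ≠ j → ∫ y, score G hθ y (e i) * score G hθ y (e j) ∂(law G 1 θ) = 0)
    (y : Fin n → Signal L) (δ : Signal L) {u ε : ℝ}
    (hu : gaussMoment L 3 ≤ u) (hε : 640 * u * ε ≤ 1)
    (hkl : lam * ‖δ‖ ^ 2 ≤ -∫ x, incr G θ δ x ∂(law G 1 θ))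
    (hml : 0 ≤ avg (fun x => incr G θ δ x) y)
    (hU : avg (fun x => (1 + ‖x‖) ^ 3) y ≤ u) (hcov : covDev G hθ y ≤ (lam / 8) ^ 2)
    (hδ : ‖δ‖ ≤ ε * lam) : lam * ‖δ‖ ^ 2 ≤ 16 * scoreDev G hθ lam e y := by
  have hu1 : 1 ≤ u := (one_le_gaussMoment 3).trans hu
  obtain ⟨d, hd⟩ : ∃ d, d = ‖δ‖ := ⟨_, rfl⟩
  have hd0 : 0 ≤ d := hd ▸ norm_nonneg δ
  obtain ⟨A, hA⟩ : ∃ A, A = ∫ x, score G hθ x δ * score G hθ x δ ∂(law G 1 θ) := ⟨_, rfl⟩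
  obtain ⟨Z, hZ⟩ : ∃ Z, Z = scoreDev G hθ lam e y := ⟨_, rfl⟩
  obtain ⟨s, hs⟩ : ∃ s, s = avg (fun x => score G hθ x δ) y := ⟨_, rfl⟩
  have hZ0 : 0 ≤ Z := hZ ▸ scoreDev_nonneg G hθ hlam e y
  have h1 := avg_score_sq_le G hθ hlam he y δ
  have h2 := avg_postCov_sub_sq_le G hθ y δ
  have h3 := avg_incr_le G hθ hn y δ
  have h4 := (abs_le.1 (abs_integral_incr_add_le G hθ δ)).1
  rw [integral_postCov] at h2
  rw [← hZ, ← hA, ← hs, ← hd] at h1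
  rw [← hA, ← hd] at h2 h4
  rw [← hs, ← hd] at h3
  rw [← hd] at hkl hδ ⊢
  rw [← hZ]
  -- Locality `d ≤ ε lam` turns the cubic remainder into a small fraction of the quadratic term.
  have hcub : 40 * d ^ 3 * u ≤ lam / 16 * d ^ 2 := by
    have : d ^ 2 * (640 * u * d) ≤ d ^ 2 * lam := by
      refine mul_le_mul_of_nonneg_left ?_ (sq_nonneg d)
      nlinarith [mul_le_mul_of_nonneg_left hδ (by linarith : (0 : ℝ) ≤ 640 * u)]
    nlinarith
  have h5 : 40 * d ^ 3 * avg (fun x => (1 + ‖x‖) ^ 3) y ≤ lam / 16 * d ^ 2 :=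
    (mul_le_mul_of_nonneg_left hU (by positivity)).trans hcub
  have h6 : 40 * (gaussMoment L 3 * d ^ 3) ≤ lam / 16 * d ^ 2 := by
    refine le_trans (le_of_eq (by ring)) ((mul_le_mul_of_nonneg_left hu
      (by positivity : 0 ≤ 40 * d ^ 3)).trans hcub)
  have h7 : avg (fun x => postCov G hθ x δ δ) y - (d ^ 2 - A) ≤ lam / 8 * d ^ 2 := by
    refine abs_le_of_sq_le_sq' (h2.trans ?_) (by positivity) |>.2
    rw [mul_pow, mul_comm]
    exact mul_le_mul_of_nonneg_right hcov (by positivity)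
  have hld : 0 ≤ lam * d ^ 2 := by positivity
  -- The divergence bound makes the Fisher form `A` dominate `lam d²`. In `h9` the nonnegative
  -- empirical increment bounds `A / 2` by the score plus an error, which `h8` absorbs to give
  -- `h10`.
  have h8 : 7 / 4 * (lam * d ^ 2) ≤ A := by linarith
  have h9 : A / 2 ≤ s + lam / 8 * d ^ 2 := by linarith
  have h10 : 3 / 7 * A ≤ s := by linarith
  have h11 : (3 / 7 * A) ^ 2 ≤ Z * (A + lam * d ^ 2) :=
    (pow_le_pow_left₀ (by linarith) h10 2).trans h1
  rcases hld.eq_or_lt with h0 | h0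
  · linarith
  · have hA0 : 0 < A := by linarith
    have h12 : A * (9 / 49 * A) ≤ A * (11 / 7 * Z) := by nlinarith
    have := le_of_mul_le_mul_left h12 hA0
    linarith

/-- The event that some grid point violates the law of large numbers at scale `w`. -/
def gridBad (G : Subgroup (O L)) [CompactSpace G] (θ : Signal L) (Q : ℕ) (M w : ℝ) (n : ℕ) :
    Set (Fin n → Signal L) :=
  ⋃ δ ∈ (grid L Q (1 / n)).filter fun δ => δ ≠ 0 ∧ ‖δ‖ ≤ M + L,
    {y | w * ‖δ‖ ≤ avg (fun x => incr G θ δ x - ∫ x, incr G θ δ x ∂(law G 1 θ)) y}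

include hθ in
/-- Consistency: off the bad event the estimation error is controlled by the grid deviation. -/
lemma sq_norm_le_of_notMem_gridBad (hn : 1 ≤ n) {lam : ℝ} (hlam : 0 < lam)
    (y : Fin n → Signal L) (δ : Signal L) {u w M : ℝ} {Q : ℕ} (hw : 0 ≤ w)
    (hu : gaussMoment L 3 ≤ u) (hQ : M * n + 1 ≤ Q)
    (hkl : lam * ‖δ‖ ^ 2 ≤ -∫ x, incr G θ δ x ∂(law G 1 θ))
    (hml : 0 ≤ avg (fun x => incr G θ δ x) y)
    (hU : avg (fun x => (1 + ‖x‖) ^ 3) y ≤ u) (hδ : ‖δ‖ ≤ M) (hy : y ∉ gridBad G θ Q M w n) :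
    ‖δ‖ ^ 2 ≤ w ^ 2 / lam ^ 2 + 2 * (w + 2 * (u + (2 * M + L))) * L / (n * lam) := by
  have hn1 : (1 : ℝ) ≤ n := by exact_mod_cast hn
  have hn' : (0 : ℝ) < n := by linarith
  have hM : 0 ≤ M := (norm_nonneg δ).trans hδ
  obtain ⟨δ', hmem, hdist⟩ := exists_mem_grid (Q := Q) (h := 1 / n) (M := M) (by positivity)
    (by rw [div_div_eq_mul_div, div_one]; exact hQ) δ hδ
  have hLn : (L : ℝ) * (1 / n) = L / n := by ring
  rw [hLn] at hdist
  have hLn' : (L : ℝ) / n ≤ L := div_le_self (Nat.cast_nonneg L) hn1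
  have hδ' : ‖δ'‖ ≤ ‖δ‖ + L / n := by
    have := norm_sub_norm_le δ' δ
    rw [norm_sub_rev] at this
    linarith
  have hδM : ‖δ'‖ ≤ M + L := by linarith
  obtain ⟨I, hI⟩ : ∃ I, I = ∫ x, incr G θ δ x ∂(law G 1 θ) := ⟨_, rfl⟩
  obtain ⟨I', hI'⟩ : ∃ I', I' = ∫ x, incr G θ δ' x ∂(law G 1 θ) := ⟨_, rfl⟩
  have hgood : avg (fun x => incr G θ δ' x) y - I' ≤ w * ‖δ'‖ := by
    -- At the origin the event in `gridBad` would read `0 ≤ 0` and always hold, so it is excluded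
    -- there; the increment vanishes anyway.
    by_cases h0 : δ' = 0
    · subst h0
      rw [hI']
      simp [incr_zero, avg]
    · by_contra hc
      push Not at hc
      refine hy ?_
      simp only [gridBad, Set.mem_iUnion]
      refine ⟨δ', Finset.mem_filter.2 ⟨hmem, h0, hδM⟩, ?_⟩
      have : avg (fun x => incr G θ δ' x - ∫ x, incr G θ δ' x ∂(law G 1 θ)) y =
          avg (fun x => incr G θ δ' x) y - I' := by
        simp_rw [sub_eq_add_neg]
        rw [avg_add, avg_const hn, hI']
      rw [Set.mem_ofPred_eq, this]
      exact hc.le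
  -- Moving to the grid costs `O(1/n)`; bounding `1 + ‖x‖` by its cube lets the single statistic
  -- bounded by `u` control the cost.
  have hlip : ∀ a b : Signal L, ‖a - b‖ ≤ L / n → ‖a‖ + ‖b‖ ≤ 2 * M + L → ∀ x,
      incr G θ a x ≤ incr G θ b x + L / n * ((1 + ‖x‖) ^ 3 + (2 * M + L)) :=
    fun a b hab hab' x => by
      have h1 := incr_sub_incr_le G hθ a b x
      have h2 : 1 + ‖x‖ ≤ (1 + ‖x‖) ^ 3 := le_self_pow₀ (by linarith [norm_nonneg x]) (by norm_num)
      have h3 : (1 + ‖x‖ + ‖a‖ + ‖b‖) * ‖a - b‖ ≤ ((1 + ‖x‖) ^ 3 + (2 * M + L)) * (L / n) :=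
        mul_le_mul (by linarith) hab (norm_nonneg _) (by positivity)
      linarith
  have hsum : ‖δ‖ + ‖δ'‖ ≤ 2 * M + L := by linarith
  have h1 : avg (fun x => incr G θ δ x) y ≤ avg (fun x => incr G θ δ' x) y +
      L / n * (u + (2 * M + L)) := by
    refine (avg_mono _ _ (hlip δ δ' hdist hsum) y).trans ?_
    rw [avg_add, avg_const_mul, avg_add, avg_const hn]
    gcongr
  have h2 : I' ≤ I + L / n * (u + (2 * M + L)) := by
    obtain ⟨hp, hp'⟩ := integrable_pow_law G hθ 3
    have hpc : Integrable (fun x => (1 + ‖x‖) ^ 3 + (2 * M + L)) (law G 1 θ) :=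
      hp.add (integrable_const _)
    have hb : Integrable (fun x => incr G θ δ x + L / n * ((1 + ‖x‖) ^ 3 + (2 * M + L)))
      (law G 1 θ) := (integrable_incr G hθ δ).add (hpc.const_mul _)
    rw [hI, hI']
    refine (integral_mono (integrable_incr G hθ δ') hb
      (hlip δ' δ (by rwa [norm_sub_rev]) (by linarith))).trans ?_
    rw [integral_add (integrable_incr G hθ δ) (hpc.const_mul _), integral_const_mul,
      integral_add hp (integrable_const _)]
    simp only [integral_const, probReal_univ, one_smul]
    gcongr
    exact hp'.trans hu
  rw [← hI] at hkl
  obtain ⟨d, hd⟩ : ∃ d, d = ‖δ‖ := ⟨_, rfl⟩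
  obtain ⟨B, hB⟩ : ∃ B, B = u + (2 * M + L) := ⟨_, rfl⟩
  rw [← hB] at h1 h2 ⊢
  rw [← hd] at hkl hδ' ⊢
  have h3 : lam * d ^ 2 ≤ w * d + (w + 2 * B) * L / n := by
    have h4 := mul_le_mul_of_nonneg_left hδ' hw
    have h5 : (w + 2 * B) * L / n = w * (L / n) + 2 * (L / n * B) := by ring
    linarith
  -- Young's inequality absorbs half of `lam d²` into the left side.
  have h4 : w * d ≤ w ^ 2 / (2 * lam) + lam * d ^ 2 / 2 := by
    have h5 : w ^ 2 / (2 * lam) + lam * d ^ 2 / 2 - w * d = (w - lam * d) ^ 2 / (2 * lam) := by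
      field_simp
      ring
    have h6 : 0 ≤ (w - lam * d) ^ 2 / (2 * lam) := by positivity
    linarith
  have h5 : d ^ 2 * (lam / 2) ≤ w ^ 2 / (2 * lam) + (w + 2 * B) * L / n := by linarith
  have h6 := (le_div_iff₀ (by positivity : 0 < lam / 2)).2 h5
  refine h6.trans_eq ?_
  field_simp

end Pointwise

/-! ### Expectations of the deviation terms and assembly of the cases. -/

section Risk

variable {L : ℕ} (G : Subgroup (O L)) [CompactSpace G] {θ : Signal L} (hθ : ‖θ‖ ≤ 1) {n : ℕ}

/-- Align `φ` optimally with `θ` inside its orbit; orbit invariance of `ell` leaves the increments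
unchanged. -/
lemma exists_direction (θ φ : Signal L) : ∃ δ : Signal L, rho G φ θ = ‖δ‖ ∧
    ∀ x, incr G θ δ x = ell G x φ - ell G x θ := by
  obtain ⟨g, hg⟩ := exists_rho_eq G θ φ
  refine ⟨act (g : O L) φ - θ, ?_, fun x => ?_⟩
  · rw [rho_comm, hg, norm_sub_rev]
  · rw [incr, add_sub_cancel, ell_act]

/-- A crude bound for any point at least as likely as `0`, which lies in every subspace. It gives
integrability of the loss, settles `n = 1` and localizes the estimator. -/
lemma rho_le_avg (hn : 1 ≤ n) (hθ : ‖θ‖ ≤ 1) (y : Fin n → Signal L) (φ : Signal L)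
    (h : 0 ≤ ∑ i, ell G (y i) φ) : rho G φ θ ≤ 2 * avg (fun x => (1 + ‖x‖) ^ 1) y := by
  have h1 := norm_le_of_sum_ell_nonneg G hn y φ h
  have h2 := rho_le G φ θ 1
  have h3 : ‖φ - act ((1 : G) : O L) θ‖ ≤ ‖φ‖ + ‖θ‖ := (norm_sub_le _ _).trans (by rw [norm_act])
  simp only [pow_one]
  rw [avg_add, avg_const hn]
  have h4 : (∑ i, ‖y i‖) / n = avg (fun x => ‖x‖) y := rfl
  linarith

lemma measurableSet_gridBad (θ : Signal L) (Q : ℕ) (M w : ℝ) (n : ℕ) :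
    MeasurableSet (gridBad G θ Q M w n) :=
  Finset.measurableSet_biUnion _ fun _ _ =>
    measurableSet_le measurable_const (measurable_avg ((measurable_incr G θ _).sub_const _))

/-- The deviation event of the grid is rare. -/
lemma measure_gridBad_le (hn : 2 ≤ n) {M w : ℝ} {K : NNReal} (hK : 0 < K)
    (hsub : ∀ δ : Signal L, ‖δ‖ ≤ M + L →
      HasSubgaussianMGF (fun y => incr G θ δ y - ∫ y, incr G θ δ y ∂(law G 1 θ))
        (K * ‖δ‖₊ ^ 2) (law G 1 θ)) (hw : 0 ≤ w)
    (hw2 : w ^ 2 = 2 * K * (((2 * ⌈M⌉₊ + 3) * L + L + 1 : ℕ) * Real.log n) / n) :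
    (Measure.pi fun _ : Fin n => law G 1 θ).real (gridBad G θ (⌈M⌉₊ * n + 1) M w n) ≤ 1 / n := by
  have hn' : (0 : ℝ) < n := by positivity
  have hK' : (0 : ℝ) < K := hK
  obtain ⟨q, hq⟩ : ∃ q, q = 2 * ⌈M⌉₊ + 3 := ⟨_, rfl⟩
  rw [← hq] at hw2
  -- The choice of `w` makes each Chernoff bound this power of `n`, one power below what the grid
  -- cardinality needs. The norm of `δ` cancels against the variance proxy.
  have hexp : Real.exp (-(n * w ^ 2) / (2 * K)) = ((n : ℝ) ^ (q * L + L + 1))⁻¹ := by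
    have : -(n * w ^ 2) / (2 * K) = -((q * L + L + 1 : ℕ) * Real.log n) := by
      rw [hw2]
      field_simp
    rw [this, Real.exp_neg, Real.exp_nat_mul, Real.exp_log hn']
  have hcard : ((grid L (⌈M⌉₊ * n + 1) (1 / n)).card : ℝ) ≤ (n : ℝ) ^ (q * L + L) := by
    -- As `n ≥ 2`, the constant `q` is at most `n ^ q`, so the cardinality is bounded by a pure
    -- power of `n`.
    have h1 : 2 * (⌈M⌉₊ * n + 1) + 1 ≤ n ^ (q + 1) := by
      calc 2 * (⌈M⌉₊ * n + 1) + 1 ≤ q * n := by rw [hq]; nlinarith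
        _ ≤ n ^ q * n := by
          gcongr
          exact Nat.lt_two_pow_self.le.trans (Nat.pow_le_pow_left hn q)
        _ = _ := (pow_succ n q).symm
    have h2 := (card_grid_le L (⌈M⌉₊ * n + 1) (1 / n)).trans (Nat.pow_le_pow_left h1 L)
    rw [← pow_mul] at h2
    calc _ ≤ ((n ^ ((q + 1) * L) : ℕ) : ℝ) := by exact_mod_cast h2
      _ = _ := by push_cast; congr 1; ring
  have hpt : ∀ δ ∈ (grid L (⌈M⌉₊ * n + 1) (1 / n)).filter fun δ => δ ≠ 0 ∧ ‖δ‖ ≤ M + L,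
      (Measure.pi fun _ : Fin n => law G 1 θ).real
        {y | w * ‖δ‖ ≤ avg (fun x => incr G θ δ x - ∫ x, incr G θ δ x ∂(law G 1 θ)) y} ≤
        ((n : ℝ) ^ (q * L + L + 1))⁻¹ := fun δ hδ => by
    obtain ⟨-, h0, hδM⟩ := Finset.mem_filter.1 hδ
    refine (measure_avg_ge_le (law G 1 θ) (by omega) ((measurable_incr G θ δ).sub_const _)
      (hsub δ hδM) (by positivity)).trans_eq ?_
    rw [← hexp]
    congr 1
    have : ‖δ‖ ≠ 0 := norm_ne_zero_iff.2 h0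
    push_cast
    field_simp
  refine (measureReal_biUnion_finset_le _ _).trans ((Finset.sum_le_sum hpt).trans ?_)
  rw [Finset.sum_const, nsmul_eq_mul]
  have hc : (((grid L (⌈M⌉₊ * n + 1) (1 / n)).filter
      fun δ => δ ≠ 0 ∧ ‖δ‖ ≤ M + L).card : ℝ) ≤ (n : ℝ) ^ (q * L + L) :=
    le_trans (by exact_mod_cast Finset.card_filter_le _ _) hcard
  refine (mul_le_mul_of_nonneg_right hc (by positivity)).trans_eq ?_
  rw [pow_succ]
  field_simp

lemma memLp_law_of_le {f : Signal L → ℝ} (hf : Measurable f) (hθ : ‖θ‖ ≤ 1) {a : ℝ} (m : ℕ)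
    (h : ∀ y, |f y| ≤ a * (1 + ‖y‖) ^ m) : MemLp f 2 (law G 1 θ) ∧
      ∫ y, f y ^ 2 ∂(law G 1 θ) ≤ a ^ 2 * gaussMoment L (m * 2) := by
  obtain ⟨h1, h2⟩ := integrable_pow_law G hθ (m * 2)
  have hb : ∀ y, f y ^ 2 ≤ a ^ 2 * (1 + ‖y‖) ^ (m * 2) := fun y => by
    rw [← sq_abs, pow_mul, ← mul_pow]
    exact pow_le_pow_left₀ (abs_nonneg _) (h y) 2
  have hi : Integrable (fun y => f y ^ 2) (law G 1 θ) :=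
    integrable_law_of_le G hθ (hf.pow_const 2) (a := a ^ 2) (m * 2) fun y => by
      rw [abs_of_nonneg (sq_nonneg _)]
      exact hb y
  refine ⟨(memLp_two_iff_integrable_sq hf.aestronglyMeasurable).2 hi,
    (integral_mono hi (h1.const_mul _) hb).trans ?_⟩
  rw [integral_const_mul]
  gcongr

lemma integral_avg_pow_sub_sq_le (hn : 1 ≤ n) (hθ : ‖θ‖ ≤ 1) :
    Integrable (fun y : Fin n → Signal L => (avg (fun x => (1 + ‖x‖) ^ 3) y -
      ∫ x, (1 + ‖x‖) ^ 3 ∂(law G 1 θ)) ^ 2) (Measure.pi fun _ => law G 1 θ) ∧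
    ∫ y : Fin n → Signal L, (avg (fun x => (1 + ‖x‖) ^ 3) y -
      ∫ x, (1 + ‖x‖) ^ 3 ∂(law G 1 θ)) ^ 2 ∂(Measure.pi fun _ => law G 1 θ) ≤
      gaussMoment L 6 / n := by
  obtain ⟨h1, h2⟩ := memLp_law_of_le G (f := fun x => (1 + ‖x‖) ^ 3) (by fun_prop) hθ (a := 1) 3
    fun y => by rw [one_mul, abs_of_nonneg (by positivity)]
  obtain ⟨h3, h4⟩ := integral_avg_sub_sq_le (law G 1 θ) hn h1
  refine ⟨h3, h4.trans ?_⟩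
  gcongr
  simpa using h2

lemma integral_covDev_le (hn : 1 ≤ n) :
    Integrable (fun y : Fin n → Signal L => covDev G hθ y) (Measure.pi fun _ => law G 1 θ) ∧
    ∫ y : Fin n → Signal L, covDev G hθ y ∂(Measure.pi fun _ => law G 1 θ) ≤
      4 * L ^ 2 * gaussMoment L 4 / n := by
  have h : ∀ p : Fin L × Fin L, _ := fun p =>
    memLp_law_of_le G (measurable_postCov G hθ (EuclideanSpace.single p.1 1)
      (EuclideanSpace.single p.2 1)) hθ (a := 2) 2
      fun y => (abs_postCov_le G hθ y _ _).trans_eq (by simp)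
  have h' := fun p => integral_avg_sub_sq_le (law G 1 θ) hn (h p).1
  refine ⟨integrable_finsetSum _ fun p _ => (h' p).1, ?_⟩
  unfold covDev
  rw [integral_finsetSum _ fun p _ => (h' p).1]
  have hs : ∀ p ∈ (Finset.univ : Finset (Fin L × Fin L)), _ ≤ 2 ^ 2 * gaussMoment L (2 * 2) / n :=
    fun p _ => (h' p).2.trans (div_le_div_of_nonneg_right (h p).2 (Nat.cast_nonneg n))
  refine (Finset.sum_le_sum hs).trans_eq ?_
  rw [Finset.sum_const, Finset.card_univ, Fintype.card_prod, Fintype.card_fin, nsmul_eq_mul]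
  push_cast
  ring

/-- Each score coordinate has variance equal to its Fisher eigenvalue, hence at most its own
normalizer: each term has mean at most `1 / n`, independently of `lam`. -/
lemma integral_scoreDev_le (hn : 1 ≤ n) {lam : ℝ} (hlam : 0 < lam)
    (e : OrthonormalBasis (Fin L) ℝ (Signal L)) :
    Integrable (fun y : Fin n → Signal L => scoreDev G hθ lam e y)
      (Measure.pi fun _ => law G 1 θ) ∧
    ∫ y : Fin n → Signal L, scoreDev G hθ lam e y ∂(Measure.pi fun _ => law G 1 θ) ≤ L / n := by
  have hn' : (0 : ℝ) < n := by positivity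
  have h : ∀ j, MemLp (fun x => score G hθ x (e j)) 2 (law G 1 θ) := fun j =>
    (memLp_law_of_le G (measurable_score G hθ (e j)) hθ (a := 1) 1
      fun y => (abs_score_le G hθ y _).trans_eq (by simp)).1
  have h' := fun j => integral_avg_sub_sq_le (law G 1 θ) hn (h j)
  simp only [integral_score, sub_zero] at h'
  refine ⟨integrable_finsetSum _ fun j _ => (h' j).1.div_const _, ?_⟩
  unfold scoreDev
  rw [integral_finsetSum _ fun j _ => (h' j).1.div_const _]
  have hs : ∀ j ∈ (Finset.univ : Finset (Fin L)), _ ≤ 1 / (n : ℝ) := fun j _ => by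
    have h0 := integral_score_sq_nonneg G hθ (e j)
    refine (integral_div _ _).trans_le ((div_le_div_of_nonneg_right (h' j).2
      (by linarith : 0 ≤ ∫ x, score G hθ x (e j) * score G hθ x (e j) ∂(law G 1 θ) + lam)).trans ?_)
    rw [div_div, div_le_div_iff₀ (by positivity) hn']
    simp only [sq]
    nlinarith
  refine (Finset.sum_le_sum hs).trans_eq ?_
  rw [Finset.sum_const, Finset.card_univ, Fintype.card_fin, nsmul_eq_mul]
  ring

/-- Replaces `√Z` by an affine function of `Z`, via AM-GM at scale `1 / √N`, so that only the mean
of `Z` is needed. -/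
lemma le_of_mul_sq_le {d lam Z N : ℝ} (hlam : 0 < lam) (hN : 0 < N) (h : lam * d ^ 2 ≤ 16 * Z) :
    d ≤ (8 * Real.sqrt N * Z + 1 / Real.sqrt N) / Real.sqrt lam := by
  have hsl : 0 < Real.sqrt lam := Real.sqrt_pos.2 hlam
  have hsn : 0 < Real.sqrt N := Real.sqrt_pos.2 hN
  rw [le_div_iff₀ hsl]
  have h3 : (d * Real.sqrt lam) ^ 2 ≤ 16 * Z := by
    rw [mul_pow, Real.sq_sqrt hlam.le]
    linarith
  obtain ⟨a, ha⟩ : ∃ a, a = d * Real.sqrt lam := ⟨_, rfl⟩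
  rw [← ha] at h3 ⊢
  have h4 : 0 ≤ Real.sqrt N / 2 * (a - 1 / Real.sqrt N) ^ 2 := by positivity
  have h5 : Real.sqrt N / 2 * (a - 1 / Real.sqrt N) ^ 2 =
      Real.sqrt N / 2 * a ^ 2 - a + 1 / Real.sqrt N / 2 := by
    field_simp
    ring
  have h6 : Real.sqrt N / 2 * a ^ 2 ≤ Real.sqrt N / 2 * (16 * Z) :=
    mul_le_mul_of_nonneg_left h3 (by positivity)
  have h7 : 0 < 1 / Real.sqrt N := by positivity
  linarith

/-- The lower bound `hd` on `d` lets one divide a bound on `d²` by `lam / u`, costing one more power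
of `lam`. The facts `1 ≤ 2 * ℓ` and `lam ≤ lamBar` merge the discretization error into the main
term. -/
lemma le_of_sq_le_of_lt {d lam lamBar w b l N κ B u ℓ : ℝ} (hlam : 0 < lam) (hle : lam ≤ lamBar)
    (hN : 0 < N) (hℓ : 1 ≤ 2 * ℓ) (hℓN : ℓ / N ≤ 1) (hκ : 0 ≤ κ) (hl : 0 ≤ l) (hb : 0 ≤ b)
    (hw2 : w ^ 2 = κ * ℓ / N) (hB : B = 2 * (1 + κ + b) * l) (hu : 0 < u)
    (h : d ^ 2 ≤ w ^ 2 / lam ^ 2 + 2 * (w + b) * l / (N * lam)) (hd : 1 / u * lam < d) :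
    d ≤ u * (κ + 2 * B * lamBar) * ℓ / (N * lam ^ 3) := by
  have hB0 : 0 ≤ B := by rw [hB]; positivity
  have hw1 : w ≤ 1 + κ := by
    have : w ^ 2 ≤ κ := by
      rw [hw2, mul_div_assoc]
      exact mul_le_of_le_one_right hκ hℓN
    nlinarith [sq_nonneg (w - 1)]
  have h2 : 2 * (w + b) * l / (N * lam) ≤ B * (2 * ℓ) * lamBar / (N * lam ^ 2) := by
    have h3 : 2 * (w + b) * l ≤ B := by
      rw [hB]
      gcongr
    rw [div_le_div_iff₀ (by positivity) (by positivity)]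
    have h4 : lam ≤ (2 * ℓ) * lamBar := by nlinarith
    calc 2 * (w + b) * l * (N * lam ^ 2) ≤ B * (N * lam ^ 2) := by gcongr
      _ = B * lam * (N * lam) := by ring
      _ ≤ B * ((2 * ℓ) * lamBar) * (N * lam) := by gcongr
      _ = _ := by ring
  have h5 : d ^ 2 ≤ (κ + 2 * B * lamBar) * ℓ / (N * lam ^ 2) := by
    refine (h.trans (add_le_add_right h2 _)).trans_eq ?_
    rw [hw2]
    field_simp
  have h0 : 0 < 1 / u * lam := by positivity
  have h6 : d * (1 / u * lam) ≤ (κ + 2 * B * lamBar) * ℓ / (N * lam ^ 2) := by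
    refine le_trans ?_ h5
    rw [sq]
    exact mul_le_mul_of_nonneg_left hd.le (h0.trans hd).le
  have h7 := (le_div_iff₀ h0).2 h6
  refine h7.trans_eq ?_
  field_simp

/-- The estimation error is bounded by a sum of explicit deviation terms. -/
lemma norm_le_deviation_terms (hn : 2 ≤ n) {lam lamBar : ℝ} (hlam : 0 < lam) (hle : lam ≤ lamBar)
    {e : OrthonormalBasis (Fin L) ℝ (Signal L)}
    (he : ∀ i j, i ≠ j → ∫ y, score G hθ y (e i) * score G hθ y (e j) ∂(law G 1 θ) = 0)
    (y : Fin n → Signal L) (δ : Signal L) {u M w κ B : ℝ}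
    (hu : u = 2 * gaussMoment L 3) (hM : M = 2 * u) (hw : 0 ≤ w) (hκ : 0 ≤ κ)
    (hw2 : w ^ 2 = κ * Real.log n / n) (hB : B = 2 * (1 + κ + 2 * (u + (2 * M + L))) * L)
    (hkl : lam * ‖δ‖ ^ 2 ≤ -∫ x, incr G θ δ x ∂(law G 1 θ))
    (hml : 0 ≤ avg (fun x => incr G θ δ x) y)
    (hδ : ‖δ‖ ≤ 2 * avg (fun x => (1 + ‖x‖) ^ 1) y) :
    ‖δ‖ ≤ 4 * (avg (fun x => (1 + ‖x‖) ^ 3) y - ∫ x, (1 + ‖x‖) ^ 3 ∂(law G 1 θ)) ^ 2 +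
      64 * M / lam ^ 2 * covDev G hθ y +
      (gridBad G θ (⌈M⌉₊ * n + 1) M w n).indicator (fun _ => M) y +
      640 * u * (κ + 2 * B * lamBar) * Real.log n / (n * lam ^ 3) +
      (8 * Real.sqrt n * scoreDev G hθ lam e y + 1 / Real.sqrt n) / Real.sqrt lam := by
  have hn1 : 1 ≤ n := by omega
  have hn' : (0 : ℝ) < n := by positivity
  have hg1 := one_le_gaussMoment (L := L) 3
  have hu2 : 2 ≤ u := by linarith
  have hM0 : 0 < M := by linarith
  have hL0 : (0 : ℝ) ≤ L := Nat.cast_nonneg L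
  have hB0 : 0 ≤ B := by
    rw [hB]
    have : 0 ≤ 1 + κ + 2 * (u + (2 * M + L)) := by linarith
    positivity
  have hlogn : 0 ≤ Real.log n := Real.log_nonneg (by exact_mod_cast hn1)
  have hlog2 : 1 ≤ 2 * Real.log n := by
    have h1 : Real.log 2 ≤ Real.log n := Real.log_le_log (by norm_num) (by exact_mod_cast hn)
    linarith [Real.log_two_gt_d9]
  have hlogle : Real.log n / n ≤ 1 := by
    rw [div_le_one hn']
    exact (Real.log_le_sub_one_of_pos hn').trans (by linarith)
  obtain ⟨d, hd⟩ : ∃ d, d = ‖δ‖ := ⟨_, rfl⟩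
  have hd0 : 0 ≤ d := hd ▸ norm_nonneg δ
  obtain ⟨U, hU⟩ : ∃ U, U = avg (fun x => (1 + ‖x‖) ^ 3) y := ⟨_, rfl⟩
  obtain ⟨m, hm⟩ : ∃ m, m = ∫ x, (1 + ‖x‖) ^ 3 ∂(law G 1 θ) := ⟨_, rfl⟩
  have hmu : m ≤ u / 2 := by
    rw [hm, hu]
    linarith [(integrable_pow_law G hθ 3).2]
  have hdU : d ≤ 2 * U := by
    rw [hd, hU]
    refine hδ.trans (mul_le_mul_of_nonneg_left (avg_mono _ _ (fun x => ?_) y) zero_le_two)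
    exact pow_le_pow_right₀ (by linarith [norm_nonneg x]) (by norm_num)
  have t1 : 0 ≤ 4 * (U - m) ^ 2 := by positivity
  have t2 : 0 ≤ 64 * M / lam ^ 2 * covDev G hθ y :=
    mul_nonneg (by positivity) (covDev_nonneg G hθ y)
  have t3 : 0 ≤ (gridBad G θ (⌈M⌉₊ * n + 1) M w n).indicator (fun _ => M) y :=
    Set.indicator_nonneg (fun _ _ => hM0.le) y
  have hlb : 0 < lamBar := hlam.trans_le hle
  have t4 : 0 ≤ 640 * u * (κ + 2 * B * lamBar) * Real.log n / (n * lam ^ 3) := by positivity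
  have t5 : 0 ≤ (8 * Real.sqrt n * scoreDev G hθ lam e y + 1 / Real.sqrt n) / Real.sqrt lam := by
    have := scoreDev_nonneg G hθ hlam e y
    positivity
  rw [← hd, ← hU, ← hm]
  -- If the empirical third moment `U` is large, then `U - m ≥ U / 2 ≥ 1`, so `d ≤ 2 U ≤ 4 (U - m) ≤
  -- 4 (U - m)²`.
  rcases lt_or_ge u U with hUu | hUu
  · have h1 : U / 2 ≤ U - m := by linarith
    have h2 : d ≤ 4 * (U - m) ^ 2 := by nlinarith
    linarith
  have hdM : d ≤ M := by linarith
  -- Now `d ≤ M`, so on each exceptional event it suffices that one term be at least `M`; the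
  -- coefficient of `covDev` is a Markov-type normalization.
  rcases lt_or_ge ((lam / 8) ^ 2) (covDev G hθ y) with hc | hc
  · have h1 : 64 * M / lam ^ 2 * (lam / 8) ^ 2 = M := by field_simp; norm_num
    have h2 : 64 * M / lam ^ 2 * (lam / 8) ^ 2 ≤ 64 * M / lam ^ 2 * covDev G hθ y :=
      mul_le_mul_of_nonneg_left hc.le (by positivity)
    linarith
  by_cases hbad : y ∈ gridBad G θ (⌈M⌉₊ * n + 1) M w n
  · have h1 : (gridBad G θ (⌈M⌉₊ * n + 1) M w n).indicator (fun _ => M) y = M :=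
      Set.indicator_of_mem hbad _
    linarith
  rcases le_or_gt d (1 / (640 * u) * lam) with hloc | hloc
  · have h1 := sq_norm_le_scoreDev G hθ hn1 hlam he y δ (u := u) (ε := 1 / (640 * u))
      (by linarith) (le_of_eq (by field_simp)) hkl hml (hU ▸ hUu) hc (hd ▸ hloc)
    rw [← hd] at h1
    have h2 := le_of_mul_sq_le hlam hn' h1
    linarith
  · have hceil : M * n + 1 ≤ ((⌈M⌉₊ * n + 1 : ℕ) : ℝ) := by
      push_cast
      have := mul_le_mul_of_nonneg_right (Nat.le_ceil M) hn'.le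
      linarith
    have h1 := sq_norm_le_of_notMem_gridBad G hθ hn1 hlam y δ (u := u) hw (by linarith) hceil hkl
      hml (hU ▸ hUu) (hd ▸ hdM) hbad
    rw [← hd] at h1
    have h2 := le_of_sq_le_of_lt hlam hle hn' hlog2 hlogle hκ hL0 (by linarith) hw2 hB
      (by linarith) h1 hloc
    linarith

end Risk

/-! ### The risk bound at unit noise. -/

section RiskBound

set_option maxHeartbeats 1000000 in
/-- Risk bound for constrained maximum likelihood at unit noise level, under a quadratic lower bound
with constant `lam` on the Kullback-Leibler divergence. -/
theorem exists_risk_bound (L : ℕ) {lamBar : ℝ} (hlb : 0 < lamBar) :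
    ∃ C₁ C₂ : ℝ, 0 < C₁ ∧ 0 < C₂ ∧ ∀ (G : Subgroup (O L)) [CompactSpace G]
      (T : Submodule ℝ (Signal L)) (θ : Signal L), ‖θ‖ ≤ 1 → θ ∈ T →
      ∀ lam : ℝ, 0 < lam → lam ≤ lamBar →
      (∀ φ ∈ T, lam * rho G φ θ ^ 2 ≤ -∫ x, incr G θ (φ - θ) x ∂(law G 1 θ)) →
      ∀ n : ℕ, 1 ≤ n → ∀ est : (Fin n → Signal L) → Signal L, Measurable est →
      (∀ y, est y ∈ T) →
      (∀ y, ∀ φ ∈ T, ∑ i, ell G (y i) φ ≤ ∑ i, ell G (y i) (est y)) →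
      Integrable (fun y => rho G (est y) θ) (Measure.pi fun _ : Fin n => law G 1 θ) ∧
      ∫ y, rho G (est y) θ ∂(Measure.pi fun _ : Fin n => law G 1 θ) ≤
        C₁ / (Real.sqrt lam * Real.sqrt n) + C₂ * (Real.log n / n) / lam ^ 3 := by
  obtain ⟨u, hu⟩ : ∃ u, u = 2 * gaussMoment L 3 := ⟨_, rfl⟩
  obtain ⟨M, hM⟩ : ∃ M, M = 2 * u := ⟨_, rfl⟩
  have hg3 := one_le_gaussMoment (L := L) 3
  have hg1 := one_le_gaussMoment (L := L) 1
  have hg4 := one_le_gaussMoment (L := L) 4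
  have hg6 := one_le_gaussMoment (L := L) 6
  have hu0 : 0 < u := by linarith
  have hM0 : 0 < M := by linarith
  have hL0 : (0 : ℝ) ≤ L := Nat.cast_nonneg L
  -- The radius is `M + L` because a grid point lies within `L / n ≤ L` of the direction it
  -- approximates.
  obtain ⟨K, hK, hsub⟩ := exists_hasSubgaussianMGF_incr L (M := M + L) (by positivity)
  obtain ⟨κ, hκ⟩ : ∃ κ : ℝ, κ = 2 * K * ((2 * ⌈M⌉₊ + 3) * L + L + 1 : ℕ) := ⟨_, rfl⟩
  have hκ0 : 0 ≤ κ := by rw [hκ]; positivity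
  obtain ⟨B, hB⟩ : ∃ B, B = 2 * (1 + κ + 2 * (u + (2 * M + L))) * L := ⟨_, rfl⟩
  have hB0 : 0 ≤ B := by rw [hB]; positivity
  obtain ⟨D, hD⟩ : ∃ D, D = 640 * u * (κ + 2 * B * lamBar) := ⟨_, rfl⟩
  have hD0 : 0 ≤ D := by rw [hD]; positivity
  obtain ⟨E, hE⟩ : ∃ E, E = 4 * L ^ 2 * gaussMoment L 4 := ⟨_, rfl⟩
  have hE0 : 0 ≤ E := by rw [hE]; positivity
  -- In the first constant, `8 * L + 1` comes from the local regime and the rest from `n = 1`. The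
  -- second collects the moment, grid and covariance events, and `D` from the far regime.
  refine ⟨8 * L + 1 + 2 * gaussMoment L 1 * Real.sqrt lamBar,
    2 * (4 * gaussMoment L 6 + M) * lamBar ^ 3 + 128 * M * E * lamBar + D, by positivity,
    by positivity, fun G _ T θ hθ hθT lam hlam hle hkl n hn est hest hmem hmax => ?_⟩
  have hn' : (0 : ℝ) < n := by positivity
  have hsl : 0 < Real.sqrt lam := Real.sqrt_pos.2 hlam
  have hsn : 0 < Real.sqrt n := Real.sqrt_pos.2 hn'
  have hρm : Measurable fun y => rho G (est y) θ := (continuous_rho_left G θ).measurable.comp hest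
  have hbase : ∀ y, rho G (est y) θ ≤ 2 * avg (fun x => (1 + ‖x‖) ^ 1) y := fun y =>
    rho_le_avg G hn hθ y (est y) (by
      have := hmax y 0 T.zero_mem
      simpa only [ell_zero, Finset.sum_const_zero] using this)
  obtain ⟨hp1, hp1'⟩ := integrable_pow_law G hθ 1
  have hbi : Integrable (fun y : Fin n → Signal L => 2 * avg (fun x => (1 + ‖x‖) ^ 1) y)
    (Measure.pi fun _ => law G 1 θ) := (integrable_avg (law G 1 θ) hp1).const_mul 2
  have hρi : Integrable (fun y => rho G (est y) θ) (Measure.pi fun _ : Fin n => law G 1 θ) :=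
    hbi.mono' hρm.aestronglyMeasurable (ae_of_all _ fun y => by
      rw [Real.norm_of_nonneg (rho_nonneg G _ _)]
      exact hbase y)
  refine ⟨hρi, ?_⟩
  -- For `n = 1` the logarithmic term vanishes, so the crude bound must fit into the first term.
  rcases hn.eq_or_lt with h1 | h2
  · refine (integral_mono hρi hbi hbase).trans ?_
    rw [integral_const_mul, integral_avg _ hn hp1, ← h1]
    simp only [Nat.cast_one, Real.sqrt_one, mul_one, Real.log_one, zero_div, mul_zero, add_zero]
    rw [le_div_iff₀ hsl]
    have h3 : Real.sqrt lam ≤ Real.sqrt lamBar := Real.sqrt_le_sqrt hle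
    calc (2 * ∫ x, (1 + ‖x‖) ^ 1 ∂(law G 1 θ)) * Real.sqrt lam
        ≤ 2 * gaussMoment L 1 * Real.sqrt lamBar := by gcongr
      _ ≤ _ := by linarith
  · have hn2 : 2 ≤ n := h2
    obtain ⟨e, he⟩ := exists_basis_score_uncorrelated G hθ
    have hlogn : 0 ≤ Real.log n := Real.log_nonneg (by exact_mod_cast hn)
    have hlog2 : 1 ≤ 2 * Real.log n := by
      have h1 : Real.log 2 ≤ Real.log n := Real.log_le_log (by norm_num) (by exact_mod_cast hn2)
      linarith [Real.log_two_gt_d9]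
    obtain ⟨w, hw⟩ : ∃ w, w = Real.sqrt (κ * Real.log n / n) := ⟨_, rfl⟩
    have hw0 : 0 ≤ w := hw ▸ Real.sqrt_nonneg _
    have hw2 : w ^ 2 = κ * Real.log n / n := by
      rw [hw, Real.sq_sqrt (by positivity)]
    have hpt : ∀ y, rho G (est y) θ ≤
        4 * (avg (fun x => (1 + ‖x‖) ^ 3) y - ∫ x, (1 + ‖x‖) ^ 3 ∂(law G 1 θ)) ^ 2 +
        64 * M / lam ^ 2 * covDev G hθ y +
        (gridBad G θ (⌈M⌉₊ * n + 1) M w n).indicator (fun _ => M) y +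
        D * Real.log n / (n * lam ^ 3) +
        (8 * Real.sqrt n * scoreDev G hθ lam e y + 1 / Real.sqrt n) / Real.sqrt lam := fun y => by
      obtain ⟨δ, hδ, hinc⟩ := exists_direction G θ (est y)
      have hinc' : ∀ x, incr G θ (est y - θ) x = incr G θ δ x := fun x => by
        rw [hinc, incr, add_sub_cancel]
      have hk := hkl (est y) (hmem y)
      simp_rw [hinc'] at hk
      rw [hδ] at hk ⊢
      rw [hD]
      refine norm_le_deviation_terms G hθ hn2 hlam hle he y δ hu hM hw0 hκ0 hw2 hB hk ?_
        (hδ ▸ hbase y)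
      refine div_nonneg ?_ hn'.le
      simp_rw [hinc]
      rw [Finset.sum_sub_distrib]
      linarith [hmax y θ hθT]
    obtain ⟨i1, i1'⟩ := integral_avg_pow_sub_sq_le G hn hθ
    obtain ⟨i2, i2'⟩ := integral_covDev_le G hθ hn
    obtain ⟨i5, i5'⟩ := integral_scoreDev_le G hθ hn hlam e
    have hbad := measurableSet_gridBad G θ (⌈M⌉₊ * n + 1) M w n
    have i3 : Integrable ((gridBad G θ (⌈M⌉₊ * n + 1) M w n).indicator fun _ => M)
      (Measure.pi fun _ => law G 1 θ) := (integrable_const M).indicator hbad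
    have i3' : ∫ y, (gridBad G θ (⌈M⌉₊ * n + 1) M w n).indicator (fun _ => M) y
        ∂(Measure.pi fun _ => law G 1 θ) ≤ M * (1 / n) := by
      rw [integral_indicator_const _ hbad, smul_eq_mul, mul_comm]
      refine mul_le_mul_of_nonneg_left (measure_gridBad_le G hn2 hK
        (fun δ hδ => hsub G θ hθ δ hδ) hw0 ?_) hM0.le
      rw [hw2, hκ]
      ring
    have j1 := i1.const_mul 4
    have j2 := i2.const_mul (64 * M / lam ^ 2)
    have j5 : Integrable (fun y : Fin n → Signal L =>
        (8 * Real.sqrt n * scoreDev G hθ lam e y + 1 / Real.sqrt n) / Real.sqrt lam)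
        (Measure.pi fun _ => law G 1 θ) :=
      ((i5.const_mul (8 * Real.sqrt n)).add (integrable_const _)).div_const _
    have j4 : Integrable (fun _ : Fin n → Signal L => D * Real.log n / (n * lam ^ 3))
      (Measure.pi fun _ => law G 1 θ) := integrable_const _
    have j5' : ∫ y : Fin n → Signal L,
        (8 * Real.sqrt n * scoreDev G hθ lam e y + 1 / Real.sqrt n) / Real.sqrt lam
        ∂(Measure.pi fun _ => law G 1 θ) = (8 * Real.sqrt n * ∫ y : Fin n → Signal L,
        scoreDev G hθ lam e y ∂(Measure.pi fun _ => law G 1 θ) + 1 / Real.sqrt n) /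
        Real.sqrt lam := by
      rw [integral_div, integral_add (i5.const_mul _) (integrable_const _), integral_const_mul]
      simp
    have hint := integral_mono hρi ((((j1.add j2).add i3).add j4).add j5) hpt
    rw [integral_add' (((j1.add j2).add i3).add j4) j5, integral_add' ((j1.add j2).add i3) j4,
      integral_add' (j1.add j2) i3, integral_add' j1 j2, integral_const_mul, integral_const_mul,
      j5'] at hint
    simp only [integral_const, probReal_univ, one_smul] at hint
    refine hint.trans ?_
    -- Since `2 log n ≥ 1` and `lam ≤ lamBar`, contributions of order `1/n` and `1 / (n lam²)` are
    -- absorbed into `log n / (n lam³)`.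
    have k1 : 1 / (n : ℝ) ≤ 2 * lamBar ^ 3 * (Real.log n / n) / lam ^ 3 := by
      have h3 : lam ^ 3 ≤ lamBar ^ 3 := pow_le_pow_left₀ hlam.le hle 3
      rw [le_div_iff₀ (by positivity), div_mul_eq_mul_div, one_mul, ← mul_div_assoc]
      refine div_le_div_of_nonneg_right ?_ hn'.le
      nlinarith [pow_pos hlb 3]
    have k2 : 1 / (n : ℝ) / lam ^ 2 ≤ 2 * lamBar * (Real.log n / n) / lam ^ 3 := by
      have h3 : 1 / (n : ℝ) / lam ^ 2 = lam / n / lam ^ 3 := by field_simp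
      rw [h3, ← mul_div_assoc]
      gcongr
      nlinarith
    have s1 : 4 * ∫ y : Fin n → Signal L, (avg (fun x => (1 + ‖x‖) ^ 3) y -
        ∫ x, (1 + ‖x‖) ^ 3 ∂(law G 1 θ)) ^ 2 ∂(Measure.pi fun _ => law G 1 θ) ≤
        4 * gaussMoment L 6 * (1 / n) := by
      rw [mul_assoc, mul_one_div]
      gcongr
    have s2 : 64 * M / lam ^ 2 * ∫ y : Fin n → Signal L, covDev G hθ y
        ∂(Measure.pi fun _ => law G 1 θ) ≤ 64 * M * E * (1 / n / lam ^ 2) := by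
      rw [← hE] at i2'
      refine (mul_le_mul_of_nonneg_left i2' (by positivity)).trans_eq ?_
      field_simp
    have s5 : (8 * Real.sqrt n * ∫ y : Fin n → Signal L, scoreDev G hθ lam e y
        ∂(Measure.pi fun _ => law G 1 θ) + 1 / Real.sqrt n) / Real.sqrt lam ≤
        (8 * L + 1) / (Real.sqrt lam * Real.sqrt n) := by
      have h3 : 8 * Real.sqrt n * (L / n) = 8 * L / Real.sqrt n := by
        nth_rw 2 [← Real.mul_self_sqrt hn'.le]
        field_simp
      rw [mul_comm (Real.sqrt lam), ← div_div]
      refine div_le_div_of_nonneg_right ?_ hsl.le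
      rw [add_div, ← h3]
      gcongr
    have s6 : (8 * (L : ℝ) + 1) / (Real.sqrt lam * Real.sqrt n) ≤
        (8 * L + 1 + 2 * gaussMoment L 1 * Real.sqrt lamBar) / (Real.sqrt lam * Real.sqrt n) := by
      refine div_le_div_of_nonneg_right ?_ (by positivity)
      have : 0 ≤ 2 * gaussMoment L 1 * Real.sqrt lamBar := by positivity
      linarith
    have s7 := mul_le_mul_of_nonneg_left k1 (by positivity : 0 ≤ 4 * gaussMoment L 6 + M)
    have s8 := mul_le_mul_of_nonneg_left k2 (by positivity : 0 ≤ 64 * M * E)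
    have s9 : (2 * (4 * gaussMoment L 6 + M) * lamBar ^ 3 + 128 * M * E * lamBar + D) *
        (Real.log n / n) / lam ^ 3 =
        (4 * gaussMoment L 6 + M) * (2 * lamBar ^ 3 * (Real.log n / n) / lam ^ 3) +
        64 * M * E * (2 * lamBar * (Real.log n / n) / lam ^ 3) +
        D * Real.log n / (n * lam ^ 3) := by
      field_simp
      ring
    rw [s9]
    linarith

end RiskBound

end OrbitModel

end

/-! ### Rescaling to noise level `σ`. -/

open MeasureTheory
theorem mainTheorem4 (L : ℕ) (k c C : ℝ) (hk : 1 ≤ k) (hc : 0 < c) (hC : 0 < C) :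
    ∃ C' : ℝ, 0 < C' ∧ ∃ C'' : ℝ, 0 < C'' ∧ ∃ Cσ : ℝ → ℝ,
      (∀ σ : ℝ, 0 < σ → Cσ σ ≤ C'' * σ ^ (6 * k - 5)) ∧
      ∀ (G : Subgroup (OrbitModel.O L)) [CompactSpace G]
        (T : Submodule ℝ (OrbitModel.Signal L)),
        (∀ θ ∈ T, ∀ φ ∈ T, ∀ σ : ℝ, c⁻¹ ≤ ‖θ‖ → ‖θ‖ ≤ c → ‖θ‖ ≤ σ →
          ENNReal.ofReal (C * σ ^ (-2 * k) * OrbitModel.rho G θ φ ^ 2) ≤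
            InformationTheory.klDiv (OrbitModel.law G σ θ) (OrbitModel.law G σ φ)) →
        ∀ θ ∈ T, ∀ σ : ℝ, c⁻¹ ≤ ‖θ‖ → ‖θ‖ ≤ c → ‖θ‖ ≤ σ →
          ∀ n : ℕ, 1 ≤ n → ∀ est : (Fin n → OrbitModel.Signal L) → OrbitModel.Signal L,
            OrbitModel.IsConstrainedMLE G T σ est →
            Integrable (fun y => OrbitModel.rho G (est y) θ)
                (Measure.pi fun _ : Fin n => OrbitModel.law G σ θ) ∧
              ∫ y, OrbitModel.rho G (est y) θ
                  ∂(Measure.pi fun _ : Fin n => OrbitModel.law G σ θ) ≤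
                C' * σ ^ k / Real.sqrt n + Cσ σ * (Real.log n / n) := by
  obtain ⟨C₁, C₂, hC₁, hC₂, hrisk⟩ := OrbitModel.exists_risk_bound L
    (lamBar := C * c⁻¹ ^ (2 - 2 * k)) (by positivity)
  refine ⟨C₁ / Real.sqrt C, by positivity, C₂ / C ^ 3, by positivity,
    fun σ => C₂ / C ^ 3 * σ ^ (6 * k - 5), fun σ _ => le_rfl, ?_⟩
  intro G _ T hkl θ hθT σ hθc hθc' hθσ n hn est hest
  have hcσ : c⁻¹ ≤ σ := hθc.trans hθσ
  have hσ : 0 < σ := (inv_pos.2 hc).trans_le hcσ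
  have hlam : 0 < C * σ ^ (2 - 2 * k) := by positivity
  -- The exponent is nonpositive as `k ≥ 1`, and `σ ≥ c⁻¹`; this is where the lower bound on `‖θ‖`
  -- enters.
  have hle : C * σ ^ (2 - 2 * k) ≤ C * c⁻¹ ^ (2 - 2 * k) :=
    mul_le_mul_of_nonneg_left
      (Real.rpow_le_rpow_of_nonpos (inv_pos.2 hc) hcσ (by linarith)) hC.le
  have hnorm : ‖σ⁻¹ • θ‖ ≤ 1 := by
    rw [norm_smul, norm_inv, Real.norm_of_nonneg hσ.le, inv_mul_le_one₀ hσ]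
    exact hθσ
  have hrho : ∀ φ, OrbitModel.rho G φ θ = σ * OrbitModel.rho G (σ⁻¹ • φ) (σ⁻¹ • θ) := fun φ => by
    rw [← OrbitModel.rho_smul G hσ.le, smul_inv_smul₀ hσ.ne', smul_inv_smul₀ hσ.ne']
  have hscale : Measurable fun (y : Fin n → OrbitModel.Signal L) (i : Fin n) => σ • y i :=
    measurable_pi_lambda _ fun i => (measurable_pi_apply i).const_smul σ
  have hpi : (Measure.pi fun _ : Fin n => OrbitModel.law G σ θ) =
      (Measure.pi fun _ : Fin n => OrbitModel.law G 1 (σ⁻¹ • θ)).map fun y i => σ • y i := by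
    have hm : Measurable fun y : OrbitModel.Signal L => σ • y := measurable_const_smul σ
    rw [Measure.pi_map_pi (f := fun _ y => σ • y) fun _ => hm.aemeasurable]
    simp_rw [← OrbitModel.law_eq_map_smul G σ hσ θ]
  have hem : Measurable fun y : Fin n → OrbitModel.Signal L => σ⁻¹ • est fun i => σ • y i :=
    (hest.measurable.comp hscale).const_smul σ⁻¹
  obtain ⟨hint, hbound⟩ := hrisk G T (σ⁻¹ • θ) hnorm (T.smul_mem _ hθT) (C * σ ^ (2 - 2 * k)) hlam
    hle (fun φ hφ => by
      have h1 := (hkl θ hθT (σ • φ) (T.smul_mem _ hφ) σ hθc hθc' hθσ).trans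
        (OrbitModel.klDiv_law_le G σ hσ θ (σ • φ))
      obtain ⟨hk1, hk2⟩ := OrbitModel.klDiv_law_one G hnorm (φ - σ⁻¹ • θ)
      rw [add_sub_cancel] at hk1
      -- The orbit distance is homogeneous of degree one, so its square contributes the factor `σ²`.
      have h2 : C * σ ^ (-2 * k) * OrbitModel.rho G θ (σ • φ) ^ 2 =
          C * σ ^ (2 - 2 * k) * OrbitModel.rho G φ (σ⁻¹ • θ) ^ 2 := by
        rw [OrbitModel.rho_comm, hrho, inv_smul_smul₀ hσ.ne', mul_pow, sub_eq_add_neg,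
          Real.rpow_add hσ, Real.rpow_two, neg_mul]
        ring
      rwa [inv_smul_smul₀ hσ.ne', hk1, h2, ENNReal.ofReal_le_ofReal_iff hk2] at h1)
    n hn (fun y => σ⁻¹ • est fun i => σ • y i) hem
    (fun y => T.smul_mem _ (hest.mem _)) fun y φ hφ => by
      have h1 := hest.isMaxOn (fun i => σ • y i) (T.smul_mem σ hφ)
      simp only [Set.mem_ofPred_eq, OrbitModel.logLik_smul G hσ, inv_smul_smul₀ hσ.ne'] at h1
      linarith
  have hρm : AEStronglyMeasurable (fun y => OrbitModel.rho G (est y) θ)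
      ((Measure.pi fun _ : Fin n => OrbitModel.law G 1 (σ⁻¹ • θ)).map fun y i => σ • y i) :=
    ((OrbitModel.continuous_rho_left G θ).measurable.comp hest.measurable).aestronglyMeasurable
  rw [hpi, integrable_map_measure hρm hscale.aemeasurable,
    integral_map hscale.aemeasurable hρm]
  simp only [Function.comp_def, hrho (est _)]
  refine ⟨hint.const_mul σ, ?_⟩
  rw [integral_const_mul]
  refine (mul_le_mul_of_nonneg_left hbound hσ.le).trans_eq ?_
  -- With `lam = C σ^(2-2k)`, the identities `hs` and `h3` convert `σ / √lam` and `σ / lam³` into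
  -- the powers `σ^k` and `σ^(6k-5)`.
  have hs : Real.sqrt (C * σ ^ (2 - 2 * k)) * σ ^ k = Real.sqrt C * σ := by
    rw [Real.sqrt_mul hC.le, Real.sqrt_eq_rpow (σ ^ (2 - 2 * k)), ← Real.rpow_mul hσ.le, mul_assoc,
      ← Real.rpow_add hσ]
    congr 1
    conv_rhs => rw [← Real.rpow_one σ]
    congr 1
    ring
  have h3 : (σ ^ (2 - 2 * k)) ^ 3 * σ ^ (6 * k - 5) = σ := by
    rw [← Real.rpow_natCast, ← Real.rpow_mul hσ.le, ← Real.rpow_add hσ]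
    conv_rhs => rw [← Real.rpow_one σ]
    congr 1
    push_cast
    ring
  have hsC : 0 < Real.sqrt C := Real.sqrt_pos.2 hC
  have hsl : 0 < Real.sqrt (C * σ ^ (2 - 2 * k)) := Real.sqrt_pos.2 hlam
  have hsn : 0 < Real.sqrt n := Real.sqrt_pos.2 (by positivity)
  have t1 : σ * (C₁ / (Real.sqrt (C * σ ^ (2 - 2 * k)) * Real.sqrt n)) =
      C₁ / Real.sqrt C * σ ^ k / Real.sqrt n := by
    rw [← mul_div_assoc, div_mul_eq_mul_div, div_div, div_eq_div_iff (by positivity) (by positivity)]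
    linear_combination (-(C₁ * Real.sqrt n)) * hs
  have t2 : σ * (C₂ * (Real.log n / n) / (C * σ ^ (2 - 2 * k)) ^ 3) =
      C₂ / C ^ 3 * σ ^ (6 * k - 5) * (Real.log n / n) := by
    have h4 : 0 < (σ ^ (2 - 2 * k)) ^ 3 := by positivity
    rw [mul_pow, ← mul_div_assoc, div_mul_eq_mul_div, div_mul_eq_mul_div,
      div_eq_div_iff (by positivity) (by positivity)]
    linear_combination (-(C₂ * (Real.log n / n) * C ^ 3)) * h3
  rw [mul_add, t1, t2]
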